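/- Let $d\ge 1$ be an integer, $0<s<d$ and $q<0$. Let $\mathbb S^d$ be the unit sphere in $\mathbb R^{d+1}$ and $\sigma_d$ its normalized surface area measure. Let $$W_s(\mathbb S^d)=\inf_\mu \iint |x-y|^{-s}\,d\mu(x)\,d\mu(y),$$ the infimum over all Borel probability measures $\mu$ on $\mathbb S^d$. For $R>1$ let $a=(0,\dots,0,R)\in\mathbb R^{d+1}$, $U_s^{\sigma_d}(R)=\int |a-y|^{-s}\,d\sigma_d(y)$, and $Q(x)=q/|x-a|^s$. A *signed $s$-equilibrium* on $\mathbb S^d$ associated with $Q$ is a finite signed Borel measure $\eta$ on $\mathbb S^d$ with $\eta(\mathbb S^d)=1$ whose Riesz potential $\int|x-y|^{-s}\,d\eta(y)$ exists (absolutely convergent) for every $x\in\mathbb S^d$ and for which $\int|x-y|^{-s}\,d\eta(y)+Q(x)$ is constant on $\mathbb S^d$. It is *a positive measure on all of $\mathbb S^d$* if $\eta\ge 0$ and $\operatorname{supp}\eta=\mathbb S^d$. A radius $R>1$ is a *critical distance* for $q$ if $$\frac{W_s(\mathbb S^d)}{q}=\frac{(R-1)^{d-s}}{(R+1)^d}-U_s^{\sigma_d}(R).$$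 The *solution to Gonchar's problem* for $q$ (exterior source) is the smallest distance from $a$ to $\mathbb S^d$, over all $R>1$ for which the signed $s$-equilibrium is a positive measure on all of $\mathbb S^d$, if such a smallest distance exists. The *Gonchar function of the third kind* is, for $R>1$, $$\mathcal G(d,s,q;R)=\Bigl(\frac{W_s(\mathbb S^d)}{q}(R+1)^d-(R-1)^{d-s}\Bigr)R^{d-1}+R^{d-1}(R+1)^d\,U_s^{\sigma_d}(R).$$ Then for every $R>1$ there is exactly one signed $s$-equilibrium $\eta_Q$ on $\mathbb S^d$ associated with $Q$, and the following hold. (i) If $-1\le q<0$, then $\eta_Q$ is a positive measure on all of $\mathbb S^d$ for every $R>1$. There is no critical distance $R>1$, and Gonchar's problem has no solution. (ii) If $q<-1$, then $\mathcal G(d,s,q;\cdot)$ has exactly one zero $R_q$ in $(1,\infty)$. For every $R>1$, $\eta_Q$ is a positive measure on all of $\mathbb S^d$ if and only if $R\ge R_q$; likewise $\eta_Q\ge 0$ if and only if $R\ge R_q$. Moreover $R_q$ is the only critical distance in $(1,\infty)$, and the solution to Gonchar's problem is $R_q-1$. (iii) If $s=d-1-2m$ for some integer $m\ge 0$, then $R\mapsto\mathcal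 G(d,d-1-2m,q;R)$ agrees on $(1,\infty)$ with a polynomial in $R$ with real coefficients. -/

import Mathlib

open MeasureTheory Metric
open scoped ENNReal

namespace RieszSphere

/-- Euclidean space `ℝ^(d+1)`. -/
abbrev Space (d : ℕ) : Type := EuclideanSpace ℝ (Fin (d + 1))

/-- The unit sphere `S^d` in `ℝ^(d+1)`, with its Borel sets. -/
abbrev Sph (d : ℕ) : Type := sphere (0 : Space d) 1

/-- The uniform (normalized surface area) probability measure `σ_d` on `S^d`. -/
noncomputable def sigma (d : ℕ) : Measure (Sph d) :=
  ((volume : Measure (Space d)).toSphere Set.univ)⁻¹ • (volume : Measure (Space d)).toSphere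

/-- The Riesz kernel `|x - y|^(-s)`; for `s > 0` it equals `∞` at `x = y`. -/
noncomputable def rieszKernel {d : ℕ} (s : ℝ) (x y : Space d) : ℝ≥0∞ :=
  (edist x y) ^ (-s)

/-- The Riesz `s`-potential at `x` of a positive measure on `S^d`. -/
noncomputable def rieszPotential {d : ℕ} (s : ℝ) (μ : Measure (Sph d)) (x : Space d) : ℝ≥0∞ :=
  ∫⁻ y : Sph d, rieszKernel s x (y : Space d) ∂μ

/-- The Riesz `s`-energy of a positive measure on `S^d`. -/
noncomputable def rieszEnergy {d : ℕ} (s : ℝ) (μ : Measure (Sph d)) : ℝ≥0∞ :=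
  ∫⁻ x : Sph d, rieszPotential s μ (x : Space d) ∂μ

/-- The Riesz `s`-energy `W_s(S^d)` of the sphere: the infimum of the energies of the Borel
probability measures on `S^d`. -/
noncomputable def sphereEnergy (d : ℕ) (s : ℝ) : ℝ :=
  (⨅ μ : ProbabilityMeasure (Sph d), rieszEnergy s (μ : Measure (Sph d))).toReal

/-- The position `a = (0, …, 0, R)` of the point charge. -/
noncomputable def source (d : ℕ) (R : ℝ) : Space d :=
  EuclideanSpace.single (Fin.last d) R

/-- The external field `Q(x) = q / |x - a|^s` of the charge `q` at `a = (0, …, 0, R)`. -/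
noncomputable def externalField (d : ℕ) (s q R : ℝ) (x : Space d) : ℝ :=
  q / (dist x (source d R)) ^ s

/-- The potential `U_s^{σ_d}(R)` of the uniform measure at a point of norm `R`. -/
noncomputable def uniformPotential (d : ℕ) (s R : ℝ) : ℝ :=
  (rieszPotential s (sigma d) (source d R)).toReal

/-- The Riesz `s`-potential at `x` of a signed measure, the difference of the potentials of its
positive and negative parts. -/
noncomputable def signedPotential {d : ℕ} (s : ℝ) (η : SignedMeasure (Sph d)) (x : Space d) : ℝ :=
  (rieszPotential s η.toJordanDecomposition.posPart x).toReal -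
    (rieszPotential s η.toJordanDecomposition.negPart x).toReal

/-- `η` is a signed `s`-equilibrium on `S^d` for the field of the charge `q` at `(0, …, 0, R)`:
a signed measure of total charge `1` whose weighted potential exists, as a finite number, and has
one and the same value everywhere on `S^d`. -/
def IsSignedEquilibrium (d : ℕ) (s q R : ℝ) (η : SignedMeasure (Sph d)) : Prop :=
  η Set.univ = 1 ∧
  (∀ x : Sph d, rieszPotential s η.totalVariation (x : Space d) < ∞) ∧
  ∃ G : ℝ, ∀ x : Sph d,
    signedPotential s η (x : Space d) + externalField d s q R (x : Space d) = G

/-- The signed measure `η` is a positive measure on all of `S^d`: it is non-negative and its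
support is the whole sphere. -/
def IsPositiveOnSphere {d : ℕ} (η : SignedMeasure (Sph d)) : Prop :=
  0 ≤ η ∧ ∀ V : Set (Sph d), IsOpen V → V.Nonempty → 0 < η V

/-- The distances from the sphere of those positions `(0, …, 0, R)`, `R > 1`, of the charge `q`
for which the signed equilibrium is a positive measure on all of `S^d`. -/
def positivityDistances (d : ℕ) (s q : ℝ) : Set ℝ :=
  {r | ∃ R : ℝ, 1 < R ∧ r = infDist (source d R) (sphere (0 : Space d) 1) ∧
    ∃ η : SignedMeasure (Sph d), IsSignedEquilibrium d s q R η ∧ IsPositiveOnSphere η}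

/-- `r` solves Gonchar's problem for the charge `q` outside the sphere: it is the smallest distance
of the charge from the sphere at which still all of the sphere is positively charged. -/
def IsGoncharSolution (d : ℕ) (s q r : ℝ) : Prop :=
  IsLeast (positivityDistances d s q) r

/-- `R` is a critical distance for the negative charge `q`: it solves the characteristic equation
`W_s(S^d) / q = |R - 1|^(d-s) / (R + 1)^d - U_s^{σ_d}(R)`. -/
def IsCriticalDistance (d : ℕ) (s q R : ℝ) : Prop :=
  sphereEnergy d s / q = |R - 1| ^ ((d : ℝ) - s) / (R + 1) ^ d - uniformPotential d s R

/-- The Gonchar function of the third kind, for `R > 1`. -/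
noncomputable def goncharC (d : ℕ) (s q R : ℝ) : ℝ :=
  (sphereEnergy d s / q * (R + 1) ^ d - (R - 1) ^ ((d : ℝ) - s)) * R ^ (d - 1)
    + R ^ (d - 1) * (R + 1) ^ d * uniformPotential d s R

end RieszSphere

/-! The signed equilibrium is written down explicitly, and its sign is read off at one point. The
tool is conformal invariance. A Lorentz boost of the light cone, read on space parts, is a map of
space homogeneous of degree one. It induces a map `T` of the sphere with `|Tx - Ty|² = |x - y|² / (t
x * t y)` and Jacobian `t^(-d)`; for a suitable boost, `t x = |x - a|² / (R² - 1)`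
(`boostNorm_eq_dist`, `dist_boost`, `lintegral_sigma_boost`). Since `σ_d` has constant potential on
the sphere, the density `(R² - 1)^(d-s) |x - a|^(s-2d)` has potential proportional to `|x - a|^(-s)`
there (`lintegral_rieszKernel_mul_balayageDensity`). Its mass is `U(R)` by Fubini. Hence `1 + (q/W)
(U(R) - balayage)` is the density of a signed equilibrium.

That the constant is `W` and that the equilibrium is unique both rest on the kernel with one point
moved off the sphere. It is a power series in `⟪x, y⟫` with positive coefficients, so its energy is
a positive combination of squared moment differences. Positivity, followed by `R → 1`, shows that
`σ_d` minimizes energy. Strictness shows that a measure is determined by its potential outside the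
sphere, and integrating against balayage densities reduces this to the potential on the sphere
(`measure_eq_of_rieszPotential_sph_eq`).

For `q < 0` the density is smallest at the pole opposite to the charge, so positivity is the
inequality `criticalFunction d s R ≤ -W/q`. Extracting `(R + 1)^(-s)` makes `criticalFunction` a
product of decreasing factors: it decreases strictly from `W` at `R = 1` and takes arbitrarily small
values. The threshold `-W/q` is at least `W` exactly when `q ≥ -1`, which separates the two cases.

The polynomial case follows from a differential recursion between the powers `s` and `s + 2`, closed
by the conformal duality `s ↔ 2d - s`. -/

namespace RieszSphere

open Set
open scoped RealInnerProductSpace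

variable {d : ℕ}

/-! ### Polar coordinates and homogeneous changes of variables on the sphere -/

section Polar

/-- Integration in polar coordinates. -/
theorem lintegral_polar {F : Space d → ℝ≥0∞} (hF : Measurable F) :
    ∫⁻ x, F x = ∫⁻ θ : Sph d, (∫⁻ r in Ioi (0 : ℝ), ENNReal.ofReal (r ^ d) * F (r • (θ : Space d)))
      ∂((volume : Measure (Space d)).toSphere) := by
  have hmp := (volume : Measure (Space d)).measurePreserving_homeomorphUnitSphereProd
  have hdim : Module.finrank ℝ (Space d) - 1 = d := by simp
  have h1 : ∫⁻ x, F x = ∫⁻ x : ({0}ᶜ : Set (Space d)), F x ∂((volume : Measure (Space d)).comap (↑)) := by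
    rw [lintegral_subtype_comap (measurableSet_singleton _).compl, restrict_compl_singleton]
  have h2 := hmp.symm (homeomorphUnitSphereProd (Space d)).toMeasurableEquiv
  have h3 := h2.lintegral_comp (f := fun x : ({0}ᶜ : Set (Space d)) => F x) (by fun_prop)
  rw [h1, ← h3, lintegral_prod _ (by fun_prop)]
  refine lintegral_congr fun θ => ?_
  rw [Measure.volumeIoiPow, hdim, lintegral_withDensity_eq_lintegral_mul _ (by fun_prop) (by fun_prop)]
  rw [← lintegral_subtype_comap measurableSet_Ioi
    (fun r : ℝ => ENNReal.ofReal (r ^ d) * F (r • (θ : Space d)))]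
  rfl

/-- This is the radial integral along a ray stretched by `t`. The power `t^(-(d+1))` is what
converts a Jacobian in space into a Jacobian on the sphere. -/
theorem lintegral_Ioi_pow_lt {t : ℝ} (ht : 0 < t) :
    ∫⁻ r in Ioi (0 : ℝ), ENNReal.ofReal (r ^ d) * (if r * t < 1 then 1 else 0) =
      ENNReal.ofReal ((t ^ (d + 1))⁻¹) * ENNReal.ofReal (((d : ℝ) + 1)⁻¹) := by
  have h : ∀ r : ℝ, ENNReal.ofReal (r ^ d) * (if r * t < 1 then (1 : ℝ≥0∞) else 0) =
      (Iio t⁻¹).indicator (fun r => ENNReal.ofReal (r ^ d)) r := by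
    intro r
    have : r * t < 1 ↔ r < t⁻¹ := by rw [← one_div, lt_div_iff₀ ht]
    by_cases hr : r < t⁻¹ <;> simp [this, hr]
  simp_rw [h]
  rw [lintegral_indicator measurableSet_Iio, Measure.restrict_restrict measurableSet_Iio,
    inter_comm, Ioi_inter_Iio, ← ofReal_integral_eq_lintegral_ofReal]
  · rw [← integral_Ioc_eq_integral_Ioo, ← intervalIntegral.integral_of_le (by positivity),
      integral_pow, ← ENNReal.ofReal_mul (by positivity)]
    congr 1
    simp
    field_simp
  · exact ((intervalIntegral.intervalIntegrable_pow (μ := volume) (a := 0) (b := t⁻¹) d).1).mono_set Ioo_subset_Ioc_self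
  · filter_upwards [ae_restrict_mem measurableSet_Ioo] with r hr
    exact pow_nonneg hr.1.le _

/-- A transformation of space that is homogeneous of degree one induces a transformation of the
sphere whose Jacobian is read off from the one in space. -/
theorem lintegral_toSphere_of_homogeneous {G : Space d → Space d} {J t : Space d → ℝ}
    (hGm : Measurable G) (hJm : Measurable J)
    (hG : ∀ F : Space d → ℝ≥0∞, Measurable F →
      ∫⁻ x, F x = ∫⁻ x, ENNReal.ofReal (J x) * F (G x))
    (hom : ∀ r : ℝ, 0 < r → ∀ θ : Sph d, G (r • (θ : Space d)) = r • G θ)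
    (homJ : ∀ r : ℝ, 0 < r → ∀ θ : Sph d, J (r • (θ : Space d)) = J θ)
    (ht : ∀ θ : Sph d, ‖G θ‖ = t θ) (ht0 : ∀ θ : Sph d, 0 < t θ)
    {g : Space d → ℝ≥0∞} (hg : Measurable g) :
    ∫⁻ θ : Sph d, g θ ∂((volume : Measure (Space d)).toSphere) =
      ∫⁻ θ : Sph d, ENNReal.ofReal (J θ * ((t θ) ^ (d + 1))⁻¹) * g ((t θ)⁻¹ • G θ)
        ∂((volume : Measure (Space d)).toSphere) := by
  -- Test the spatial formula on the radial extension of `g` cut off to the unit ball: on both sides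
  -- the radial integrals then separate and leave the same constant `1/(d+1)`.
  have hFm : Measurable fun x : Space d => g (‖x‖⁻¹ • x) * (if ‖x‖ < 1 then 1 else 0) := by
    refine (hg.comp (by fun_prop)).mul (Measurable.ite ?_ measurable_const measurable_const)
    exact measurableSet_lt (by fun_prop) (by fun_prop)
  have h := hG _ hFm
  have hc : ENNReal.ofReal (((d : ℝ) + 1)⁻¹) ≠ 0 := by
    rw [Ne, ENNReal.ofReal_eq_zero]; push Not; positivity
  have hFGm : Measurable fun x => ENNReal.ofReal (J x) *
      (g (‖G x‖⁻¹ • G x) * (if ‖G x‖ < 1 then 1 else 0)) :=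
    hJm.ennreal_ofReal.mul (hFm.comp hGm)
  rw [lintegral_polar hFm, lintegral_polar hFGm] at h
  have hm : ∀ a : ℝ, Measurable fun r : ℝ => ENNReal.ofReal (r ^ d) *
      (if r * a < 1 then (1 : ℝ≥0∞) else 0) := fun a =>
    (by fun_prop : Measurable fun r : ℝ => ENNReal.ofReal (r ^ d)).mul
      (Measurable.ite (measurableSet_lt (by fun_prop) (by fun_prop)) measurable_const
        measurable_const)
  have hl : ∀ θ : Sph d, ∫⁻ r in Ioi (0 : ℝ), ENNReal.ofReal (r ^ d) *
      (g (‖r • (θ : Space d)‖⁻¹ • r • (θ : Space d)) *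
        (if ‖r • (θ : Space d)‖ < 1 then 1 else 0)) =
      g θ * ENNReal.ofReal (((d : ℝ) + 1)⁻¹) := by
    intro θ
    have hθ : ‖(θ : Space d)‖ = 1 := by simp
    have := lintegral_Ioi_pow_lt (d := d) one_pos
    simp only [one_pow, inv_one, ENNReal.ofReal_one, one_mul] at this
    rw [← this, ← lintegral_const_mul _ (hm 1)]
    refine setLIntegral_congr_fun measurableSet_Ioi fun r hr => ?_
    have hr : 0 < r := hr
    simp only [norm_smul, hθ, Real.norm_eq_abs, abs_of_pos hr, mul_one, smul_smul,
      inv_mul_cancel₀ hr.ne', one_smul]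
    ring
  have hrr : ∀ θ : Sph d, ∫⁻ r in Ioi (0 : ℝ), ENNReal.ofReal (r ^ d) *
      (ENNReal.ofReal (J (r • (θ : Space d))) * (g (‖G (r • (θ : Space d))‖⁻¹ • G (r • (θ : Space d))) *
        (if ‖G (r • (θ : Space d))‖ < 1 then 1 else 0))) =
      ENNReal.ofReal (J θ * ((t θ) ^ (d + 1))⁻¹) * g ((t θ)⁻¹ • G θ) *
        ENNReal.ofReal (((d : ℝ) + 1)⁻¹) := by
    intro θ
    have hθ := ht0 θ
    have hpos : 0 ≤ ((t θ) ^ (d + 1))⁻¹ := by positivity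
    calc _ = ∫⁻ r in Ioi (0 : ℝ), ENNReal.ofReal (r ^ d) * (if r * t θ < 1 then 1 else 0) *
          (ENNReal.ofReal (J θ) * g ((t θ)⁻¹ • G θ)) := by
          refine setLIntegral_congr_fun measurableSet_Ioi fun r hr => ?_
          have hr : 0 < r := hr
          have : (r * t θ)⁻¹ * r = (t θ)⁻¹ := by field_simp
          simp only [hom r hr, homJ r hr, norm_smul, ht, Real.norm_eq_abs, abs_of_pos hr,
            smul_smul, this]
          ring
      _ = _ := by
          rw [lintegral_mul_const _ (hm _), lintegral_Ioi_pow_lt hθ, ENNReal.ofReal_mul' hpos]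
          ring
  simp only [hl, hrr] at h
  rwa [lintegral_mul_const' _ _ ENNReal.ofReal_ne_top, lintegral_mul_const' _ _ ENNReal.ofReal_ne_top,
    ENNReal.mul_left_inj hc ENNReal.ofReal_ne_top] at h

/-- Linear isometries preserve the surface measure. -/
theorem lintegral_toSphere_comp_isometry (L : Space d ≃ₗᵢ[ℝ] Space d)
    {g : Space d → ℝ≥0∞} (hg : Measurable g) :
    ∫⁻ θ : Sph d, g (L θ) ∂((volume : Measure (Space d)).toSphere) =
      ∫⁻ θ : Sph d, g θ ∂((volume : Measure (Space d)).toSphere) := by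
  rw [lintegral_toSphere_of_homogeneous (G := L) (J := fun _ => 1) (t := fun _ => 1)
    (by fun_prop) (by fun_prop) ?_ (fun r _ θ => by simp) (fun _ _ _ => rfl) (fun θ => by simp)
    (fun _ => one_pos) hg]
  · simp
  · intro F hF
    simpa using (L.measurePreserving.lintegral_comp hF).symm

end Polar

/-! ### Lorentz boosts and the conformal maps of the sphere -/

section Boost

/-- The time component of the Lorentz boost of the light-like vector `(x, ‖x‖)`. -/
noncomputable def boostNorm (c b : ℝ) (e x : Space d) : ℝ := c * ‖x‖ + b * ⟪e, x⟫

/-- The space component of the Lorentz boost in direction `e` of the light-like vector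
`(x, ‖x‖)`. -/
noncomputable def boost (c b : ℝ) (e x : Space d) : Space d :=
  x + ((c - 1) * ⟪e, x⟫ + b * ‖x‖) • e

variable {c b : ℝ} {e : Space d}

theorem inner_boost (he : ‖e‖ = 1) (x : Space d) :
    ⟪e, boost c b e x⟫ = c * ⟪e, x⟫ + b * ‖x‖ := by
  simp only [boost, inner_add_right, inner_smul_right, real_inner_self_eq_norm_sq, he]
  ring

theorem boostNorm_pos (hc : 0 < c) (hcb : c ^ 2 - b ^ 2 = 1) (he : ‖e‖ = 1) {x : Space d}
    (hx : x ≠ 0) : 0 < boostNorm c b e x := by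
  have h1 : |⟪e, x⟫| ≤ ‖x‖ := by simpa [he] using abs_real_inner_le_norm e x
  have h2 : |b| < c := abs_lt_of_sq_lt_sq (by linarith) hc.le
  have h3 : 0 < ‖x‖ := norm_pos_iff.2 hx
  have h4 : |b * ⟪e, x⟫| ≤ |b| * ‖x‖ := by rw [abs_mul]; gcongr
  have h5 : |b| * ‖x‖ < c * ‖x‖ := by gcongr
  have := neg_abs_le (b * ⟪e, x⟫)
  unfold boostNorm
  linarith

/-- Invariance of the Lorentz form under the boost, for light-like vectors with time components
`‖x‖` and `‖y‖`. The case `x = y` says that the light cone is preserved. -/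
theorem inner_boost_boost (hcb : c ^ 2 - b ^ 2 = 1) (he : ‖e‖ = 1) (x y : Space d) :
    ⟪boost c b e x, boost c b e y⟫ =
      ⟪x, y⟫ - ‖x‖ * ‖y‖ + boostNorm c b e x * boostNorm c b e y := by
  simp only [boost, boostNorm, inner_add_right, inner_smul_right, inner_add_left, inner_smul_left,
    real_inner_self_eq_norm_sq, he, real_inner_comm e x, RCLike.conj_to_real]
  linear_combination (⟪e, x⟫ * ⟪e, y⟫ - ‖x‖ * ‖y‖) * hcb

theorem norm_boost (hc : 0 < c) (hcb : c ^ 2 - b ^ 2 = 1) (he : ‖e‖ = 1) (x : Space d) :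
    ‖boost c b e x‖ = boostNorm c b e x := by
  rcases eq_or_ne x 0 with rfl | hx
  · simp [boost, boostNorm]
  have h := inner_boost_boost hcb he x x
  rw [real_inner_self_eq_norm_sq, real_inner_self_eq_norm_sq] at h
  refine (sq_eq_sq₀ (norm_nonneg _) (boostNorm_pos hc hcb he hx).le).1 ?_
  linear_combination h

theorem boost_boost_neg (hc : 0 < c) (hcb : c ^ 2 - b ^ 2 = 1) (he : ‖e‖ = 1) (x : Space d) :
    boost c (-b) e (boost c b e x) = x := by
  rw [boost, inner_boost he, norm_boost hc hcb he]
  simp only [boost, boostNorm]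
  rw [add_assoc, ← add_smul]
  convert add_zero x
  rw [smul_eq_zero]
  left
  linear_combination ⟪e, x⟫ * hcb

theorem boost_smul {r : ℝ} (hr : 0 < r) (x : Space d) : boost c b e (r • x) = r • boost c b e x := by
  simp only [boost, inner_smul_right, norm_smul, Real.norm_eq_abs, abs_of_pos hr, smul_add, smul_smul]
  congr 2
  ring

theorem continuous_boost : Continuous (boost c b e) := by
  unfold boost; fun_prop

theorem continuous_boostNorm : Continuous (boostNorm c b e) := by
  unfold boostNorm; fun_prop

/-- The Jacobian of the boost. -/
theorem lintegral_boost (hc : 0 < c) (hcb : c ^ 2 - b ^ 2 = 1) (he : ‖e‖ = 1)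
    (F : Space d → ℝ≥0∞) :
    ∫⁻ x, F x = ∫⁻ x, ENNReal.ofReal (boostNorm c b e x / ‖x‖) * F (boost c b e x) := by
  have hne : ∀ x : Space d, x ≠ 0 → boost c b e x ≠ 0 := fun x hx => by
    rw [← norm_pos_iff, norm_boost hc hcb he]; exact boostNorm_pos hc hcb he hx
  have himg : boost c b e '' {0}ᶜ = {0}ᶜ := by
    ext y
    constructor
    · rintro ⟨x, hx, rfl⟩; exact hne x hx
    · intro hy
      have hcb' : c ^ 2 - (-b) ^ 2 = 1 := by linear_combination hcb
      refine ⟨boost c (-b) e y, ?_, by simpa using boost_boost_neg hc hcb' he y⟩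
      rw [mem_compl_singleton_iff, ← norm_pos_iff, norm_boost hc hcb' he]
      exact boostNorm_pos hc hcb' he hy
  have hinj : InjOn (boost c b e) {0}ᶜ :=
    (Function.LeftInverse.injective (boost_boost_neg hc hcb he)).injOn
  -- The boost moves points only along `e`, so its derivative is a rank-one perturbation of the
  -- identity and its determinant is `1 + ℓ x e`.
  let ℓ : Space d → (Space d →L[ℝ] ℝ) := fun x =>
    (c - 1) • innerSL ℝ e + (b * ‖x‖⁻¹) • innerSL ℝ x
  have hderiv : ∀ x ∈ ({0}ᶜ : Set (Space d)), HasFDerivWithinAt (boost c b e)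
      (ContinuousLinearMap.id ℝ _ + (ℓ x).smulRight e) {0}ᶜ x := by
    intro x hx
    have hn : HasFDerivAt (fun x : Space d => ‖x‖) (‖x‖⁻¹ • innerSL ℝ x) x := by
      have h := (hasStrictFDerivAt_norm_sq x).hasFDerivAt.sqrt
        (pow_ne_zero 2 (norm_ne_zero_iff.2 hx))
      simp only [Real.sqrt_sq (norm_nonneg _)] at h
      refine h.congr_fderiv ?_
      ext y
      simp
      field_simp
    refine HasFDerivAt.hasFDerivWithinAt ?_
    refine (hasFDerivAt_id x).add ?_
    refine HasFDerivAt.smul_const ?_ e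
    have := (((innerSL ℝ e).hasFDerivAt (x := x)).const_mul (c - 1)).add (hn.const_mul b)
    exact this.congr_fderiv (by ext y; simp [ℓ, mul_assoc])
  have h := lintegral_image_eq_lintegral_abs_det_fderiv_mul volume
    (measurableSet_singleton (0 : Space d)).compl hderiv hinj F
  rw [himg, restrict_compl_singleton] at h
  rw [h]
  have hae : ∀ᵐ x : Space d, x ≠ 0 := by
    rw [ae_iff]; simp
  refine lintegral_congr_ae (hae.mono fun x hx => ?_)
  have hdet : (ContinuousLinearMap.id ℝ _ + (ℓ x).smulRight e).det = boostNorm c b e x / ‖x‖ := by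
    have : ((ContinuousLinearMap.id ℝ _ + (ℓ x).smulRight e : Space d →L[ℝ] Space d) :
        Space d →ₗ[ℝ] Space d) = LinearMap.transvection ((ℓ x : Space d →L[ℝ] ℝ) : Space d →ₗ[ℝ] ℝ) e := by
      ext1 y; simp [LinearMap.transvection]
    rw [ContinuousLinearMap.det, this, LinearMap.transvection.det]
    have hx' : ‖x‖ ≠ 0 := norm_ne_zero_iff.2 hx
    simp [ℓ, he, boostNorm, real_inner_comm]
    field_simp
    ring
  simp only [hdet, abs_of_pos (div_pos (boostNorm_pos hc hcb he hx) (norm_pos_iff.2 hx))]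

/-- The conformal change of variables on the sphere. -/
theorem lintegral_toSphere_boost (hc : 0 < c) (hcb : c ^ 2 - b ^ 2 = 1) (he : ‖e‖ = 1)
    {g : Space d → ℝ≥0∞} (hg : Measurable g) :
    ∫⁻ θ : Sph d, g θ ∂((volume : Measure (Space d)).toSphere) =
      ∫⁻ θ : Sph d, ENNReal.ofReal (((boostNorm c b e θ) ^ d)⁻¹) *
        g ((boostNorm c b e θ)⁻¹ • boost c b e θ) ∂((volume : Measure (Space d)).toSphere) := by
  have hθ0 : ∀ θ : Sph d, (θ : Space d) ≠ 0 := fun θ => by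
    rw [← norm_pos_iff]; simp
  rw [lintegral_toSphere_of_homogeneous (G := boost c b e)
    (J := fun x => boostNorm c b e x / ‖x‖) (t := boostNorm c b e)
    continuous_boost.measurable (continuous_boostNorm.measurable.div measurable_norm)
    (fun F _ => lintegral_boost hc hcb he F) (fun r hr θ => boost_smul hr _) ?_
    (fun θ => norm_boost hc hcb he _) (fun θ => boostNorm_pos hc hcb he (hθ0 θ)) hg]
  · refine lintegral_congr fun θ => ?_
    have := boostNorm_pos hc hcb he (hθ0 θ)
    congr 2
    simp
    field_simp
    ring
  · intro r hr θ
    simp [boostNorm, inner_smul_right, norm_smul, abs_of_pos hr]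
    field_simp

end Boost

/-! ### The uniform measure and its radial potential -/

section Sigma

theorem norm_coe_sph (θ : Sph d) : ‖(θ : Space d)‖ = 1 := by simp

theorem toSphere_univ_ne_zero : (volume : Measure (Space d)).toSphere univ ≠ 0 := by
  have : (volume : Measure (Space d)).toSphere ≠ 0 := Measure.toSphere_ne_zero _
  rwa [Ne, Measure.measure_univ_eq_zero]

instance : IsProbabilityMeasure (sigma d) :=
  ⟨by rw [sigma, Measure.smul_apply, smul_eq_mul,
    ENNReal.inv_mul_cancel toSphere_univ_ne_zero (measure_ne_top _ _)]⟩

instance : (sigma d).IsOpenPosMeasure :=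
  Measure.isOpenPosMeasure_smul _ (ENNReal.inv_ne_zero.2 (measure_ne_top _ _))

theorem lintegral_sigma_comp_isometry (L : Space d ≃ₗᵢ[ℝ] Space d)
    {g : Space d → ℝ≥0∞} (hg : Measurable g) :
    ∫⁻ θ, g (L (θ : Space d)) ∂(sigma d) = ∫⁻ θ, g (θ : Space d) ∂(sigma d) := by
  rw [sigma, lintegral_smul_measure, lintegral_smul_measure, lintegral_toSphere_comp_isometry L hg]

theorem lintegral_sigma_boost {c b : ℝ} {e : Space d} (hc : 0 < c) (hcb : c ^ 2 - b ^ 2 = 1)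
    (he : ‖e‖ = 1) {g : Space d → ℝ≥0∞} (hg : Measurable g) :
    ∫⁻ θ, g (θ : Space d) ∂(sigma d) =
      ∫⁻ θ, ENNReal.ofReal (((boostNorm c b e (θ : Space d)) ^ d)⁻¹) *
        g ((boostNorm c b e (θ : Space d))⁻¹ • boost c b e (θ : Space d)) ∂(sigma d) := by
  rw [sigma, lintegral_smul_measure, lintegral_smul_measure, lintegral_toSphere_boost hc hcb he hg]

theorem measurable_rieszKernel (s : ℝ) (x : Space d) :
    Measurable fun y : Space d => rieszKernel s x y := by
  unfold rieszKernel; fun_prop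

theorem measurable_rieszKernel_uncurry (s : ℝ) :
    Measurable fun p : Space d × Space d => rieszKernel s p.1 p.2 := by
  unfold rieszKernel; fun_prop

theorem rieszKernel_comm (s : ℝ) (x y : Space d) : rieszKernel s x y = rieszKernel s y x := by
  rw [rieszKernel, rieszKernel, edist_comm]

theorem rieszKernel_toReal (s : ℝ) (x y : Space d) :
    (rieszKernel s x y).toReal = dist x y ^ (-s) := by
  rw [rieszKernel, ← ENNReal.toReal_rpow, edist_dist, ENNReal.toReal_ofReal dist_nonneg]

theorem rieszKernel_of_ne (s : ℝ) {x y : Space d} (h : x ≠ y) :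
    rieszKernel s x y = ENNReal.ofReal (dist x y ^ (-s)) := by
  rw [rieszKernel, edist_dist, ENNReal.ofReal_rpow_of_pos (dist_pos.2 h)]

/-- The potential of the uniform measure is radial. -/
theorem rieszPotential_sigma_congr (s : ℝ) {x y : Space d} (h : ‖x‖ = ‖y‖) :
    rieszPotential s (sigma d) x = rieszPotential s (sigma d) y := by
  -- The reflection in the bisecting hyperplane carries `x` to `y`, the norms being equal.
  set L := Submodule.reflection (ℝ ∙ (x - y))ᗮ with hL
  have hxy : L x = y := Submodule.reflection_sub h
  rw [rieszPotential, rieszPotential,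
    ← lintegral_sigma_comp_isometry L (measurable_rieszKernel s y)]
  refine lintegral_congr fun θ => ?_
  rw [← hxy, rieszKernel, rieszKernel, L.edist_map]

/-- The constant value on the sphere of the potential of the uniform measure. -/
noncomputable def uniformConst (d : ℕ) (s : ℝ) : ℝ≥0∞ := rieszPotential s (sigma d) (source d 1)

theorem norm_source (R : ℝ) : ‖source d R‖ = |R| := by simp [source]

theorem rieszPotential_sigma_sph (s : ℝ) {x : Space d} (hx : ‖x‖ = 1) :
    rieszPotential s (sigma d) x = uniformConst d s :=
  rieszPotential_sigma_congr s (by rw [hx, norm_source, abs_one])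

end Sigma

/-! ### The boost adapted to the source, and balayage of a point charge -/

section Dilation

variable {R : ℝ} {e : Space d}

/-- The boost parameters are chosen so that the conformal factor is a multiple of `|x - R e|²`; this
is what ties the conformal map to the charge at `R • e`. -/
theorem boostNorm_eq_dist (hR : 1 < R) (he : ‖e‖ = 1) {x : Space d} (hx : ‖x‖ = 1) :
    boostNorm ((R ^ 2 + 1) / (R ^ 2 - 1)) (-(2 * R) / (R ^ 2 - 1)) e x =
      dist x (R • e) ^ 2 / (R ^ 2 - 1) := by
  have : R ^ 2 - 1 ≠ 0 := by nlinarith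
  rw [dist_eq_norm, norm_sub_sq_real, boostNorm, inner_smul_right, norm_smul, hx, he,
    Real.norm_eq_abs, mul_pow, sq_abs, real_inner_comm]
  field_simp
  ring

theorem dist_smul_pos (hR : 1 < R) (he : ‖e‖ = 1) {x : Space d} (hx : ‖x‖ = 1) :
    0 < dist x (R • e) := by
  rw [dist_pos]
  rintro rfl
  rw [norm_smul, he, mul_one, Real.norm_eq_abs, abs_of_pos (by linarith)] at hx
  exact hR.ne' hx

theorem boost_coeff_sq (hR : 1 < R) :
    ((R ^ 2 + 1) / (R ^ 2 - 1)) ^ 2 - (-(2 * R) / (R ^ 2 - 1)) ^ 2 = 1 := by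
  have : R ^ 2 - 1 ≠ 0 := by nlinarith
  field_simp
  ring

theorem boost_coeff_pos (hR : 1 < R) : 0 < (R ^ 2 + 1) / (R ^ 2 - 1) :=
  div_pos (by positivity) (by nlinarith)

/-- On the unit sphere `|x - y|² = 2 (1 - ⟪x, y⟫)` is, up to a factor, the Lorentz product of the
light-like lifts. The boost preserves that product, and rescaling to the sphere divides it by the
two time components. -/
theorem dist_boost {c b : ℝ} (hc : 0 < c) (hcb : c ^ 2 - b ^ 2 = 1) (he : ‖e‖ = 1)
    {x y : Space d} (hx : ‖x‖ = 1) (hy : ‖y‖ = 1) :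
    dist ((boostNorm c b e x)⁻¹ • boost c b e x) ((boostNorm c b e y)⁻¹ • boost c b e y) ^ 2 =
      dist x y ^ 2 * ((boostNorm c b e x)⁻¹ * (boostNorm c b e y)⁻¹) := by
  have hx0 := boostNorm_pos hc hcb he (x := x) (norm_pos_iff.1 (by rw [hx]; exact one_pos))
  have hy0 := boostNorm_pos hc hcb he (x := y) (norm_pos_iff.1 (by rw [hy]; exact one_pos))
  rw [dist_eq_norm, dist_eq_norm, norm_sub_sq_real, norm_sub_sq_real, norm_smul, norm_smul,
    norm_boost hc hcb he, norm_boost hc hcb he, inner_smul_left, inner_smul_right,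
    inner_boost_boost hcb he, hx, hy, Real.norm_eq_abs, Real.norm_eq_abs,
    abs_of_pos (inv_pos.2 hx0), abs_of_pos (inv_pos.2 hy0), inv_mul_cancel₀ hx0.ne',
    inv_mul_cancel₀ hy0.ne']
  simp only [RCLike.conj_to_real]
  field_simp
  ring

theorem rieszKernel_boost (s : ℝ) {c b : ℝ} (hc : 0 < c) (hcb : c ^ 2 - b ^ 2 = 1) (he : ‖e‖ = 1)
    {x y : Space d} (hx : ‖x‖ = 1) (hy : ‖y‖ = 1) :
    rieszKernel s ((boostNorm c b e x)⁻¹ • boost c b e x)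
      ((boostNorm c b e y)⁻¹ • boost c b e y) =
      rieszKernel s x y *
        ENNReal.ofReal (boostNorm c b e x ^ (s / 2) * boostNorm c b e y ^ (s / 2)) := by
  have hx0 := boostNorm_pos hc hcb he (x := x) (norm_pos_iff.1 (by rw [hx]; exact one_pos))
  have hy0 := boostNorm_pos hc hcb he (x := y) (norm_pos_iff.1 (by rw [hy]; exact one_pos))
  have h := dist_boost hc hcb he hx hy
  set p := boostNorm c b e x
  set q := boostNorm c b e y
  have h' : dist (p⁻¹ • boost c b e x) (q⁻¹ • boost c b e y) =
      dist x y * (p * q) ^ (-(1 / 2 : ℝ)) := by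
    refine (sq_eq_sq₀ dist_nonneg (by positivity)).1 ?_
    rw [h, mul_pow, ← Real.rpow_natCast (_ ^ _), ← Real.rpow_mul (by positivity)]
    norm_num [Real.rpow_neg_one, mul_comm]
  have hpq : 0 < (p * q) ^ (-(1 / 2 : ℝ)) := by positivity
  rw [rieszKernel, rieszKernel, edist_dist, h', ENNReal.ofReal_mul dist_nonneg,
    ENNReal.mul_rpow_of_ne_top ENNReal.ofReal_ne_top ENNReal.ofReal_ne_top, ← edist_dist,
    ENNReal.ofReal_rpow_of_pos hpq, ← Real.rpow_mul (by positivity),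
    ← Real.mul_rpow hx0.le hy0.le]
  congr 3
  ring

/-- The density, up to normalization, of the balayage onto the sphere of a unit charge at `R • e`. -/
noncomputable def balayageDensity (s R : ℝ) (e x : Space d) : ℝ :=
  (R ^ 2 - 1) ^ ((d : ℝ) - s) * dist x (R • e) ^ (s - 2 * d)

theorem balayageDensity_pos (s : ℝ) (hR : 1 < R) (he : ‖e‖ = 1) {x : Space d} (hx : ‖x‖ = 1) :
    0 < balayageDensity s R e x := by
  have := dist_smul_pos hR he hx
  have : 0 < R ^ 2 - 1 := by nlinarith
  unfold balayageDensity
  positivity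

theorem measurable_balayageDensity (s R : ℝ) (e : Space d) :
    Measurable (balayageDensity s R e) := by
  unfold balayageDensity; fun_prop

/-- The potential of the balayage density is on the sphere the potential of the point charge. -/
theorem lintegral_rieszKernel_mul_balayageDensity (s : ℝ) (hR : 1 < R) (he : ‖e‖ = 1)
    {x : Space d} (hx : ‖x‖ = 1) :
    ∫⁻ y, rieszKernel s x (y : Space d) * ENNReal.ofReal (balayageDensity s R e (y : Space d))
      ∂(sigma d) = uniformConst d s * rieszKernel s x (R • e) := by
  have hc := boost_coeff_pos hR
  have hcb := boost_coeff_sq hR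
  set c := (R ^ 2 + 1) / (R ^ 2 - 1)
  set b := -(2 * R) / (R ^ 2 - 1)
  have ht : ∀ {y : Space d}, ‖y‖ = 1 → boostNorm c b e y = dist y (R • e) ^ 2 / (R ^ 2 - 1) :=
    fun hy => boostNorm_eq_dist hR he hy
  have hpos : ∀ {y : Space d}, ‖y‖ = 1 → 0 < dist y (R • e) := fun hy => dist_smul_pos hR he hy
  have hR1 : 0 < R ^ 2 - 1 := by nlinarith
  have hx0 := boostNorm_pos hc hcb he (x := x) (norm_pos_iff.1 (by rw [hx]; exact one_pos))
  have hnx : ‖(boostNorm c b e x)⁻¹ • boost c b e x‖ = 1 := by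
    rw [norm_smul, norm_boost hc hcb he, norm_inv, Real.norm_eq_abs, abs_of_pos hx0,
      inv_mul_cancel₀ hx0.ne']
  -- Replace the constant by the potential at the image of `x` and change variables by the boost;
  -- the remaining identity is between integrands.
  rw [← rieszPotential_sigma_sph s hnx, rieszPotential,
    lintegral_sigma_boost hc hcb he (measurable_rieszKernel s _),
    ← lintegral_mul_const _ (by
      refine Measurable.mul ?_ ((measurable_rieszKernel s _).comp ?_)
      · have := (continuous_boostNorm (c := c) (b := b) (e := e)).measurable
        fun_prop
      · have h1 := (continuous_boostNorm (c := c) (b := b) (e := e)).measurable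
        have h2 := (continuous_boost (c := c) (b := b) (e := e)).measurable
        fun_prop)]
  refine lintegral_congr fun y => ?_
  have hy := norm_coe_sph y
  have hy0 := hpos hy
  have hx1 := hpos hx
  rw [rieszKernel_boost s hc hcb he hx hy, ht hy, ht hx, rieszKernel_of_ne s (dist_pos.1 hx1),
    mul_left_comm, mul_assoc, ← ENNReal.ofReal_mul (by positivity),
    ← ENNReal.ofReal_mul (by positivity)]
  congr 2
  set p := dist x (R • e)
  set u := dist (y : Space d) (R • e)
  set w := R ^ 2 - 1
  rw [balayageDensity, Real.div_rpow (by positivity) hR1.le, Real.div_rpow (by positivity) hR1.le,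
    ← Real.rpow_natCast p, ← Real.rpow_natCast u, ← Real.rpow_mul hx1.le, ← Real.rpow_mul hy0.le,
    div_pow, ← Real.rpow_natCast w, ← Real.rpow_natCast _ d,
    ← Real.rpow_mul hy0.le]
  simp only [Nat.cast_ofNat, mul_div_cancel₀ _ (two_ne_zero' ℝ)]
  change w ^ ((d : ℝ) - s) * u ^ (s - 2 * d) = _
  rw [Real.rpow_sub hR1, Real.rpow_sub hy0, Real.rpow_neg hx1.le]
  have hw : w ^ (s / 2) * w ^ (s / 2) = w ^ s := by
    rw [← Real.rpow_add hR1]; ring_nf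
  have hp := Real.rpow_pos_of_pos hx1 s
  rw [← hw]
  field_simp

end Dilation

/-! ### Measure of caps and finiteness of the energy -/

section Finiteness

/-- The conformal map for `R = 1 + δ` has Jacobian at least `(2δ)^(-d)` on the cap, because `|θ - R
e| ≤ 2δ` there, and its Jacobian integrates to `1`. -/
theorem sigma_closedBall_le {e : Space d} (he : ‖e‖ = 1) {δ : ℝ} (hδ : 0 < δ) :
    sigma d {θ | dist (θ : Space d) e ≤ δ} ≤ ENNReal.ofReal ((2 * δ) ^ d) := by
  have hR : 1 < 1 + δ := by linarith
  have hc := boost_coeff_pos hR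
  have hcb := boost_coeff_sq hR
  have h := lintegral_sigma_boost (d := d) hc hcb he (g := fun _ => 1) measurable_const
  simp only [lintegral_const, measure_univ, mul_one] at h
  have hm : MeasurableSet {θ : Sph d | dist (θ : Space d) e ≤ δ} :=
    measurableSet_le (by fun_prop) measurable_const
  have h2 : ∫⁻ θ in {θ : Sph d | dist (θ : Space d) e ≤ δ},
      ENNReal.ofReal (((2 * δ) ^ d)⁻¹) ∂(sigma d) ≤ 1 := by
    rw [h]
    refine (setLIntegral_mono' hm fun θ hθ => ?_).trans (setLIntegral_le_lintegral _ _)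
    have hpos := dist_smul_pos hR he (norm_coe_sph θ)
    have hR1 : 0 < (1 + δ) ^ 2 - 1 := by nlinarith
    rw [boostNorm_eq_dist hR he (norm_coe_sph θ)]
    refine ENNReal.ofReal_le_ofReal (inv_anti₀ (by positivity) ?_)
    gcongr
    rw [div_le_iff₀ hR1]
    have h3 : dist (θ : Space d) ((1 + δ) • e) ≤ 2 * δ := by
      refine (dist_triangle _ e _).trans ?_
      have : dist e ((1 + δ) • e) = δ := by
        rw [dist_comm, dist_eq_norm, add_smul, one_smul, add_sub_cancel_left, norm_smul, he,
          mul_one, Real.norm_eq_abs, abs_of_pos hδ]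
      have hθ' : dist (θ : Space d) e ≤ δ := hθ
      linarith
    have h4 : dist (θ : Space d) ((1 + δ) • e) ^ 2 ≤ (2 * δ) ^ 2 := by gcongr
    nlinarith [pow_pos hδ 3]
  rw [setLIntegral_const, ENNReal.ofReal_inv_of_pos (by positivity)] at h2
  rwa [ENNReal.inv_mul_le_iff (by simpa using by positivity) ENNReal.ofReal_ne_top, mul_one] at h2

theorem sigma_singleton (hd : d ≠ 0) {e : Space d} (he : ‖e‖ = 1) :
    sigma d {θ | (θ : Space d) = e} = 0 := by
  refine le_antisymm (le_of_forall_gt fun ε hε => ?_) (zero_le)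
  have ht : Filter.Tendsto (fun δ : ℝ => ENNReal.ofReal ((2 * δ) ^ d)) (nhdsWithin 0 (Ioi 0)) (nhds 0) := by
    have : Continuous fun δ : ℝ => ENNReal.ofReal ((2 * δ) ^ d) :=
      ENNReal.continuous_ofReal.comp (by fun_prop)
    have h := (this.tendsto 0).mono_left (nhdsWithin_le_nhds (s := Ioi 0))
    simpa [hd] using h
  obtain ⟨δ, h1, h2⟩ := ((ht.eventually_lt_const hε).and self_mem_nhdsWithin).exists
  refine lt_of_le_of_lt ((measure_mono ?_).trans (sigma_closedBall_le he h2)) h1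
  intro θ hθ
  have : (θ : Space d) = e := hθ
  simpa [this] using (le_of_lt h2 : (0 : ℝ) ≤ δ)

theorem ae_sigma_ne (hd : d ≠ 0) {e : Space d} (he : ‖e‖ = 1) :
    ∀ᵐ θ : Sph d ∂(sigma d), e ≠ (θ : Space d) := by
  rw [ae_iff]
  simpa [eq_comm] using sigma_singleton hd he

/-- Layer-cake formula: the level set `|θ - e|⁻¹ ≥ t` is a cap of measure at most `min 1 ((2/t)^d)`.
Against `t^(s-1)` this converges at `0` because `s > 0` and at infinity because `s < d`. -/
theorem uniformConst_lt_top {s : ℝ} (hs : 0 < s) (hsd : s < d) : uniformConst d s < ∞ := by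
  have hd : d ≠ 0 := by rintro rfl; simp at hsd; linarith
  have he : ‖source d 1‖ = 1 := by simp [norm_source]
  set e := source d 1
  have h1 : uniformConst d s = ∫⁻ θ, ENNReal.ofReal ((dist (θ : Space d) e)⁻¹ ^ s) ∂(sigma d) := by
    refine lintegral_congr_ae ((ae_sigma_ne hd he).mono fun θ hθ => ?_)
    change rieszKernel s e θ = ENNReal.ofReal ((dist (θ : Space d) e)⁻¹ ^ s)
    rw [rieszKernel_of_ne s hθ, Real.rpow_neg dist_nonneg, Real.inv_rpow dist_nonneg, dist_comm]
  rw [h1, lintegral_rpow_eq_lintegral_meas_le_mul _ (ae_of_all _ fun θ => by positivity)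
    (by fun_prop) hs]
  refine ENNReal.mul_lt_top ENNReal.ofReal_lt_top ?_
  rw [← Ioc_union_Ioi_eq_Ioi zero_le_one]
  refine (lintegral_union_le _ _ _).trans_lt (ENNReal.add_lt_top.2 ⟨?_, ?_⟩)
  · have hi : IntegrableOn (fun t : ℝ => t ^ (s - 1)) (Ioc 0 1) :=
      (intervalIntegral.intervalIntegrable_rpow' (by linarith)).1
    refine lt_of_le_of_lt (lintegral_mono fun t => ?_) hi.lintegral_lt_top
    exact mul_le_of_le_one_left zero_le prob_le_one
  · have hi : IntegrableOn (fun t : ℝ => 2 ^ d * t ^ (s - 1 - d)) (Ioi 1) :=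
      (integrableOn_Ioi_rpow_of_lt (by linarith) one_pos).const_mul _
    refine lt_of_le_of_lt (setLIntegral_mono' measurableSet_Ioi fun t ht => ?_) hi.lintegral_lt_top
    have ht0 : 0 < t := lt_trans one_pos ht
    have h2 : sigma d {θ | t ≤ (dist (θ : Space d) e)⁻¹} ≤ ENNReal.ofReal ((2 * t⁻¹) ^ d) := by
      refine (measure_mono fun θ hθ => ?_).trans (sigma_closedBall_le he (inv_pos.2 ht0))
      exact le_inv_of_le_inv₀ ht0 hθ
    calc _ ≤ ENNReal.ofReal ((2 * t⁻¹) ^ d) * ENNReal.ofReal (t ^ (s - 1)) := by gcongr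
      _ = _ := by
        rw [← ENNReal.ofReal_mul (by positivity), Real.rpow_sub ht0 _ (d : ℝ), Real.rpow_natCast, mul_pow,
          inv_pow]
        congr 1
        field_simp

theorem rieszKernel_antitone {s : ℝ} (hs : 0 < s) {x y x' y' : Space d}
    (h : dist x y ≤ dist x' y') : rieszKernel s x' y' ≤ rieszKernel s x y := by
  rw [rieszKernel, rieszKernel, ENNReal.rpow_neg, ENNReal.rpow_neg, edist_dist, edist_dist]
  gcongr

theorem uniformConst_pos {s : ℝ} (hs : 0 < s) : 0 < uniformConst d s := by
  have he : ‖source d 1‖ = 1 := by simp [norm_source]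
  have h : ∀ θ : Sph d, ENNReal.ofReal (2 ^ (-s)) ≤ rieszKernel s (source d 1) (θ : Space d) := by
    intro θ
    have h0 : edist (source d 1) (θ : Space d) ≤ ENNReal.ofReal 2 := by
      rw [edist_dist]
      refine ENNReal.ofReal_le_ofReal ?_
      have := dist_le_norm_add_norm (source d 1) (θ : Space d)
      rw [he, norm_coe_sph] at this
      linarith
    rw [rieszKernel, ← ENNReal.ofReal_rpow_of_pos two_pos, ENNReal.rpow_neg, ENNReal.rpow_neg]
    gcongr
  have h2 := lintegral_mono (μ := sigma d) h
  rw [lintegral_const, measure_univ, mul_one] at h2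
  refine lt_of_lt_of_le ?_ h2
  rw [ENNReal.ofReal_pos]
  positivity

end Finiteness

/-! ### The uniform potential outside the sphere and the mass of the balayage -/

section Exterior

variable {R : ℝ} {e : Space d}

theorem dist_le_dist_smul (hR : 1 ≤ R) (he : ‖e‖ = 1) {x : Space d} (hx : ‖x‖ = 1) {R' : ℝ}
    (hR' : R ≤ R') : dist x (R • e) ≤ dist x (R' • e) := by
  refine (sq_le_sq₀ dist_nonneg dist_nonneg).1 ?_
  have h1 : ⟪x, e⟫ ≤ 1 := by simpa [hx, he] using real_inner_le_norm x e
  rw [dist_eq_norm, dist_eq_norm, norm_sub_sq_real, norm_sub_sq_real, inner_smul_right,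
    inner_smul_right, norm_smul, norm_smul, hx, he, mul_one, mul_one, Real.norm_eq_abs,
    Real.norm_eq_abs, sq_abs, sq_abs]
  nlinarith [mul_nonneg (sub_nonneg.2 hR') (sub_nonneg.2 h1)]

theorem rieszKernel_smul_le {s : ℝ} (hs : 0 < s) (hR : 1 ≤ R) (he : ‖e‖ = 1) {x : Space d}
    (hx : ‖x‖ = 1) : rieszKernel s (R • e) x ≤ rieszKernel s e x := by
  have := dist_le_dist_smul le_rfl he hx hR
  rw [one_smul, dist_comm, dist_comm x] at this
  exact rieszKernel_antitone hs this

theorem source_eq_smul (R : ℝ) : source d R = R • source d 1 := by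
  ext i; simp [source, EuclideanSpace.single]

theorem continuous_source : Continuous (source d) := by
  rw [funext source_eq_smul]
  fun_prop

theorem rieszPotential_sigma_smul (s R : ℝ) (he : ‖e‖ = 1) :
    rieszPotential s (sigma d) (R • e) = rieszPotential s (sigma d) (source d R) :=
  rieszPotential_sigma_congr s (by rw [norm_smul, he, norm_source, mul_one, Real.norm_eq_abs])

theorem rieszPotential_source_le {s : ℝ} (hs : 0 < s) (hR : 1 ≤ R) :
    rieszPotential s (sigma d) (source d R) ≤ uniformConst d s := by
  refine lintegral_mono fun θ => ?_
  rw [source_eq_smul]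
  exact rieszKernel_smul_le hs hR (by simp [norm_source]) (norm_coe_sph θ)

theorem rieszPotential_source_lt_top {s : ℝ} (hs : 0 < s) (hsd : s < d) (hR : 1 ≤ R) :
    rieszPotential s (sigma d) (source d R) < ∞ :=
  (rieszPotential_source_le hs hR).trans_lt (uniformConst_lt_top hs hsd)

theorem uniformPotential_eq_integral {s : ℝ} (hs : 0 < s) (hsd : s < d) (hR : 1 ≤ R) :
    uniformPotential d s R = ∫ θ, dist (source d R) (θ : Space d) ^ (-s) ∂(sigma d) := by
  have h := rieszPotential_source_lt_top hs hsd hR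
  have hm : Measurable fun θ : Sph d => rieszKernel s (source d R) (θ : Space d) :=
    (measurable_rieszKernel s _).comp measurable_subtype_coe
  rw [uniformPotential, rieszPotential, ← integral_toReal hm.aemeasurable
    (ae_lt_top hm h.ne)]
  simp only [rieszKernel_toReal]

theorem uniformPotential_one {s : ℝ} : uniformPotential d s 1 = (uniformConst d s).toReal := rfl

theorem integrable_dist_rpow {s : ℝ} (hs : 0 < s) (hsd : s < d) (hR : 1 ≤ R) :
    Integrable (fun θ : Sph d => dist (source d R) (θ : Space d) ^ (-s)) (sigma d) := by
  have h := rieszPotential_source_lt_top hs hsd hR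
  have hm : Measurable fun θ : Sph d => rieszKernel s (source d R) (θ : Space d) :=
    (measurable_rieszKernel s _).comp measurable_subtype_coe
  have := integrable_toReal_of_lintegral_ne_top hm.aemeasurable h.ne
  simpa only [rieszKernel_toReal] using this

/-- Moving the source outwards increases its distance to every point of the sphere, so the integrand
at `R = 1` dominates. Continuity up to the endpoint `R = 1` is the point: both energy minimality and
the limit of `criticalFunction` use it. -/
theorem continuousOn_uniformPotential {s : ℝ} (hs : 0 < s) (hsd : s < d) :
    ContinuousOn (uniformPotential d s) (Ici 1) := by
  have hd : d ≠ 0 := by rintro rfl; simp at hsd; linarith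
  have he : ‖source d 1‖ = 1 := by simp [norm_source]
  have hcongr : EqOn (uniformPotential d s)
      (fun R => ∫ θ : Sph d, dist (source d R) (θ : Space d) ^ (-s) ∂(sigma d)) (Ici 1) :=
    fun R hR => uniformPotential_eq_integral hs hsd hR
  refine ContinuousOn.congr ?_ hcongr
  have hpos : ∀ θ : Sph d, source d 1 ≠ (θ : Space d) → ∀ R : ℝ, 1 ≤ R →
      0 < dist (source d R) (θ : Space d) := by
    intro θ hθ R hR
    have := dist_le_dist_smul le_rfl he (norm_coe_sph θ) hR
    rw [one_smul, ← source_eq_smul, dist_comm, dist_comm (θ : Space d)] at this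
    exact (dist_pos.2 hθ).trans_le this
  refine continuousOn_of_dominated (bound := fun θ : Sph d => dist (source d 1) (θ : Space d) ^ (-s))
    (fun R _ => Measurable.aestronglyMeasurable (by fun_prop)) (fun R hR => ?_) (integrable_dist_rpow hs hsd le_rfl) ?_
  · filter_upwards [ae_sigma_ne hd he] with θ hθ
    rw [Real.norm_eq_abs, abs_of_nonneg (by positivity)]
    refine Real.rpow_le_rpow_of_nonpos (dist_pos.2 hθ) ?_ (by linarith)
    have := dist_le_dist_smul le_rfl he (norm_coe_sph θ) hR
    rwa [one_smul, ← source_eq_smul, dist_comm, dist_comm (θ : Space d)] at this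
  · filter_upwards [ae_sigma_ne hd he] with θ hθ R hR
    refine ContinuousAt.continuousWithinAt ?_
    refine ContinuousAt.rpow_const ?_ (Or.inl (hpos θ hθ R hR).ne')
    exact (continuous_source.dist continuous_const).continuousAt

/-- The mass of the balayage density. -/
theorem lintegral_balayageDensity {s : ℝ} (hs : 0 < s) (hsd : s < d) (hR : 1 < R) (he : ‖e‖ = 1) :
    ∫⁻ y, ENNReal.ofReal (balayageDensity s R e (y : Space d)) ∂(sigma d) =
      ENNReal.ofReal (uniformPotential d s R) := by
  have hW0 := (uniformConst_pos (d := d) hs).ne'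
  have hW := (uniformConst_lt_top hs hsd).ne
  have hbm := (measurable_balayageDensity s R e)
  have hkm := measurable_rieszKernel_uncurry (d := d) s
  -- Integrate the balayage identity against `σ_d` and exchange the integrals; the inner integral is
  -- then the constant potential of `σ_d`, which cancels.
  have h : uniformConst d s * rieszPotential s (sigma d) (source d R) = uniformConst d s *
      ∫⁻ y, ENNReal.ofReal (balayageDensity s R e (y : Space d)) ∂(sigma d) := by
    calc _ = uniformConst d s * rieszPotential s (sigma d) (R • e) := by
          rw [rieszPotential_sigma_smul s R he]
      _ = ∫⁻ x, uniformConst d s * rieszKernel s (x : Space d) (R • e) ∂(sigma d) := by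
          rw [rieszPotential, lintegral_const_mul' _ _ hW]
          simp only [rieszKernel_comm s (R • e)]
      _ = ∫⁻ x, ∫⁻ y, rieszKernel s (x : Space d) (y : Space d) *
            ENNReal.ofReal (balayageDensity s R e (y : Space d)) ∂(sigma d) ∂(sigma d) :=
          lintegral_congr fun x =>
            (lintegral_rieszKernel_mul_balayageDensity s hR he (norm_coe_sph x)).symm
      _ = ∫⁻ y, ∫⁻ x, rieszKernel s (x : Space d) (y : Space d) *
            ENNReal.ofReal (balayageDensity s R e (y : Space d)) ∂(sigma d) ∂(sigma d) :=
          lintegral_lintegral_swap (Measurable.aemeasurable (by fun_prop))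
      _ = ∫⁻ y, uniformConst d s * ENNReal.ofReal (balayageDensity s R e (y : Space d)) ∂(sigma d) := by
          refine lintegral_congr fun y => ?_
          rw [lintegral_mul_const' _ _ ENNReal.ofReal_ne_top]
          simp only [rieszKernel_comm s _ (y : Space d)]
          rw [← rieszPotential, rieszPotential_sigma_sph s (norm_coe_sph y)]
      _ = _ := by rw [lintegral_const_mul' _ _ hW]
  rw [ENNReal.mul_right_inj hW0 hW] at h
  rw [← h, uniformPotential, ENNReal.ofReal_toReal (rieszPotential_source_lt_top hs hsd hR.le).ne]

theorem integrable_balayageDensity {s : ℝ} (hs : 0 < s) (hsd : s < d) (hR : 1 < R) (he : ‖e‖ = 1) :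
    Integrable (fun y : Sph d => balayageDensity s R e (y : Space d)) (sigma d) := by
  refine (lintegral_ofReal_ne_top_iff_integrable
    ((measurable_balayageDensity s R e).comp measurable_subtype_coe).aestronglyMeasurable
    (ae_of_all _ fun y => (balayageDensity_pos s hR he (norm_coe_sph y)).le)).1 ?_
  have := lintegral_balayageDensity hs hsd hR he
  exact this ▸ ENNReal.ofReal_ne_top

theorem integral_balayageDensity {s : ℝ} (hs : 0 < s) (hsd : s < d) (hR : 1 < R) (he : ‖e‖ = 1) :
    ∫ y, balayageDensity s R e (y : Space d) ∂(sigma d) = uniformPotential d s R := by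
  rw [integral_eq_lintegral_of_nonneg_ae
    (ae_of_all _ fun y => (balayageDensity_pos s hR he (norm_coe_sph y)).le)
    ((measurable_balayageDensity s R e).comp measurable_subtype_coe).aestronglyMeasurable,
    lintegral_balayageDensity hs hsd hR he]
  exact ENNReal.toReal_ofReal ENNReal.toReal_nonneg

end Exterior

/-! ### Moments of measures on the sphere and power series kernels -/

section Moments

/-- The binomial series of `(1 - w) ^ (-α)` has positive coefficients when `0 < α`. -/
theorem exists_pos_hasSum_one_sub_rpow_neg {α : ℝ} (hα : 0 < α) :
    ∃ A : ℕ → ℝ, (∀ k, 0 < A k) ∧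
      ∀ w : ℝ, |w| < 1 → HasSum (fun k => A k * w ^ k) ((1 - w) ^ (-α)) := by
  refine ⟨fun n => Ring.choose (α + n - 1) n, fun n => ?_, fun w hw => ?_⟩
  · have h : Ring.choose (α + n - 1) n = Ring.multichoose α n := by
      rw [Ring.choose]; congr 1; ring
    have h2 := Ring.factorial_nsmul_multichoose_eq_ascPochhammer α n
    rw [Polynomial.ascPochhammer_smeval_eq_eval, nsmul_eq_mul] at h2
    have h3 := ascPochhammer_pos n α hα
    rw [← h2] at h3
    simp only [h]
    exact pos_of_mul_pos_right h3 (by positivity)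
  · have h := (Real.one_div_one_sub_rpow_hasFPowerSeriesOnBall_zero α).hasSum (y := w)
      (by simpa [enorm_eq_nnnorm] using! hw)
    have hw1 : 0 ≤ 1 - w := by linarith [le_abs_self w]
    simpa [FormalMultilinearSeries.ofScalars, Real.rpow_neg hw1, mul_comm] using h

/-- A monomial in the coordinates. -/
def monomial {k : ℕ} (p : Fin k → Fin (d + 1)) (x : Space d) : ℝ := ∏ j, x (p j)

theorem continuous_monomial {k : ℕ} (p : Fin k → Fin (d + 1)) :
    Continuous (monomial p : Space d → ℝ) := by
  unfold monomial; fun_prop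

/-- Writing the power as a sum of products `f x * f y` shows that it is a positive definite kernel,
and turns its energy into a sum of squared moments. -/
theorem inner_pow_eq_sum (x y : Space d) (k : ℕ) :
    ⟪x, y⟫ ^ k = ∑ p : Fin k → Fin (d + 1), monomial p x * monomial p y := by
  rw [PiLp.inner_apply, Fintype.sum_pow]
  simp [monomial, Finset.prod_mul_distrib, mul_comm]

theorem integrable_of_continuous {X : Type*} [TopologicalSpace X] [CompactSpace X]
    [MeasurableSpace X] [OpensMeasurableSpace X] {μ : Measure X} [IsFiniteMeasure μ] {E : Type*}
    [NormedAddCommGroup E] [SecondCountableTopology E] {f : X → E} (hf : Continuous f) :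
    Integrable f μ := by
  borelize E
  obtain ⟨C, hC⟩ := isCompact_univ.exists_bound_of_continuousOn hf.continuousOn
  exact Integrable.of_bound hf.stronglyMeasurable.aestronglyMeasurable C
    (ae_of_all _ fun x => hC x (mem_univ x))

variable (μ ν : Measure (Sph d))

/-- The defect of the measures `μ` and `ν` in the moments of order `k`. -/
noncomputable def momentDefect (k : ℕ) : ℝ :=
  ∑ p : Fin k → Fin (d + 1),
    ((∫ x, monomial p (x : Space d) ∂μ) - ∫ x, monomial p (x : Space d) ∂ν) ^ 2

theorem momentDefect_nonneg (k : ℕ) : 0 ≤ momentDefect μ ν k :=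
  Finset.sum_nonneg fun _ _ => sq_nonneg _

variable [IsFiniteMeasure μ] [IsFiniteMeasure ν]

/-- The integral of a function of two points against a product of measures on the sphere. -/
noncomputable def pairing (f : Space d → Space d → ℝ) : ℝ :=
  ∫ p : Sph d × Sph d, f p.1 p.2 ∂(μ.prod ν)

theorem pairing_comm {f : Space d → Space d → ℝ} (hf : ∀ x y : Sph d, f x y = f y x) :
    pairing μ ν f = pairing ν μ f := by
  rw [pairing, pairing, ← integral_prod_swap]
  simp only [Prod.fst_swap, Prod.snd_swap]
  exact integral_congr_ae (ae_of_all _ fun p => hf _ _)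

theorem pairing_inner_pow (k : ℕ) : pairing μ ν (fun x y => ⟪x, y⟫ ^ k) =
    ∑ p : Fin k → Fin (d + 1), (∫ x, monomial p (x : Space d) ∂μ) *
      ∫ x, monomial p (x : Space d) ∂ν := by
  simp only [pairing, inner_pow_eq_sum]
  rw [integral_finsetSum]
  · refine Finset.sum_congr rfl fun p _ => ?_
    rw [← integral_prod_mul]
  · intro p _
    refine integrable_of_continuous ?_
    have := continuous_monomial (d := d) p
    fun_prop

theorem momentDefect_eq (k : ℕ) : momentDefect μ ν k =
    pairing μ μ (fun x y => ⟪x, y⟫ ^ k) - 2 * pairing μ ν (fun x y => ⟪x, y⟫ ^ k) +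
      pairing ν ν (fun x y => ⟪x, y⟫ ^ k) := by
  simp only [pairing_inner_pow, momentDefect, Finset.mul_sum, ← Finset.sum_sub_distrib,
    ← Finset.sum_add_distrib]
  exact Finset.sum_congr rfl fun p _ => by ring

theorem abs_inner_sph_le (x y : Sph d) : |⟪(x : Space d), (y : Space d)⟫| ≤ 1 := by
  simpa using abs_real_inner_le_norm (x : Space d) y

theorem hasSum_pairing {A : ℕ → ℝ} (hA : ∀ k, 0 < A k) {F : ℝ → ℝ}
    (hF : ∀ w : ℝ, |w| < 1 → HasSum (fun k => A k * w ^ k) (F w)) {z : ℝ} (hz0 : 0 ≤ z)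
    (hz : z < 1) :
    HasSum (fun k => A k * z ^ k * pairing μ ν (fun x y => ⟪x, y⟫ ^ k))
      (pairing μ ν fun x y => F (z * ⟪x, y⟫)) := by
  have hcont : ∀ k, Continuous fun p : Sph d × Sph d =>
      A k * (z * ⟪(p.1 : Space d), (p.2 : Space d)⟫) ^ k := fun k => by fun_prop
  have hsum : Summable fun k => A k * z ^ k := (hF z (by rwa [abs_of_nonneg hz0])).summable
  have h := hasSum_integral_of_summable_integral_norm (μ := μ.prod ν)
    (F := fun k (p : Sph d × Sph d) => A k * (z * ⟪(p.1 : Space d), (p.2 : Space d)⟫) ^ k)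
    (fun k => integrable_of_continuous (hcont k)) ?_
  · have hl : ∀ p : Sph d × Sph d, ∑' k, A k * (z * ⟪(p.1 : Space d), (p.2 : Space d)⟫) ^ k =
        F (z * ⟪(p.1 : Space d), (p.2 : Space d)⟫) := by
      intro p
      refine (hF _ ?_).tsum_eq
      rw [abs_mul, abs_of_nonneg hz0]
      have := abs_inner_sph_le p.1 p.2
      nlinarith
    simp only [hl] at h
    refine Eq.subst (motive := fun f => HasSum f _) (funext fun k => ?_) h
    rw [pairing, ← integral_const_mul]
    simp only [mul_pow, mul_assoc]
  · refine Summable.of_nonneg_of_le (fun k => integral_nonneg fun _ => norm_nonneg _) (fun k => ?_)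
      (hsum.mul_right ((μ.prod ν).real univ))
    rw [mul_comm, ← smul_eq_mul, ← integral_const]
    refine integral_mono (integrable_of_continuous (hcont k)).norm (integrable_const _) fun p => ?_
    have := abs_inner_sph_le p.1 p.2
    simp only [norm_mul, norm_pow, Real.norm_eq_abs, abs_of_pos (hA k), abs_of_nonneg hz0]
    gcongr
    · exact (hA k).le
    · exact mul_le_of_le_one_right hz0 this

/-- The sum is the energy of `μ - ν` for the kernel `F (z ⟪x, y⟫)`. The condition `z < 1` keeps the
argument inside the disc of convergence uniformly on the sphere, which permits termwise integration.
-/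
theorem hasSum_momentDefect {A : ℕ → ℝ} (hA : ∀ k, 0 < A k) {F : ℝ → ℝ}
    (hF : ∀ w : ℝ, |w| < 1 → HasSum (fun k => A k * w ^ k) (F w)) {z : ℝ} (hz0 : 0 ≤ z)
    (hz : z < 1) :
    HasSum (fun k => A k * z ^ k * momentDefect μ ν k)
      (pairing μ μ (fun x y => F (z * ⟪x, y⟫)) - 2 * pairing μ ν (fun x y => F (z * ⟪x, y⟫)) +
        pairing ν ν (fun x y => F (z * ⟪x, y⟫))) := by
  have h := ((hasSum_pairing μ μ hA hF hz0 hz).sub ((hasSum_pairing μ ν hA hF hz0 hz).mul_left 2)).add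
    (hasSum_pairing ν ν hA hF hz0 hz)
  refine Eq.subst (motive := fun f => HasSum f _) (funext fun k => ?_) h
  rw [momentDefect_eq]
  ring

theorem integral_inner_pow_eq (h : ∀ k, momentDefect μ ν k = 0) (w : Space d) (k : ℕ) :
    ∫ x, ⟪(x : Space d), w⟫ ^ k ∂μ = ∫ x, ⟪(x : Space d), w⟫ ^ k ∂ν := by
  have hp : ∀ p : Fin k → Fin (d + 1), ∫ x, monomial p (x : Space d) ∂μ =
      ∫ x, monomial p (x : Space d) ∂ν := by
    intro p
    have := (Finset.sum_eq_zero_iff_of_nonneg fun _ _ => sq_nonneg _).1 (h k) p (Finset.mem_univ p)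
    exact sub_eq_zero.1 (pow_eq_zero_iff two_ne_zero |>.1 this)
  have hi : ∀ (m : Measure (Sph d)) [IsFiniteMeasure m] (p : Fin k → Fin (d + 1)),
      Integrable (fun x : Sph d => monomial p (x : Space d) * monomial p w) m := by
    intro m _ p
    refine integrable_of_continuous ?_
    have := continuous_monomial (d := d) p
    fun_prop
  simp only [inner_pow_eq_sum]
  rw [integral_finsetSum _ fun p _ => hi μ p, integral_finsetSum _ fun p _ => hi ν p]
  simp only [integral_mul_const, hp]

/-- Finite measures on the sphere with the same moments agree. -/
theorem measure_eq_of_momentDefect_eq_zero (h : ∀ k, momentDefect μ ν k = 0) : μ = ν := by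
  have hemb : MeasurableEmbedding (Subtype.val : Sph d → Space d) :=
    MeasurableEmbedding.subtype_coe isClosed_sphere.measurableSet
  -- On the bounded sphere the exponential series may be integrated termwise, so the moments
  -- determine the characteristic function.
  have key : ∀ (m : Measure (Sph d)) [IsFiniteMeasure m] (w : Space d),
      HasSum (fun k : ℕ => Complex.I ^ k / k.factorial * ((∫ x, ⟪(x : Space d), w⟫ ^ k ∂m : ℝ) : ℂ))
        (charFun (m.map Subtype.val) w) := by
    intro m _ w
    have hb : ∀ x : Sph d, |⟪(x : Space d), w⟫| ≤ ‖w‖ := fun x => by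
      simpa using abs_real_inner_le_norm (x : Space d) w
    have hc : ∀ k : ℕ, Continuous fun x : Sph d =>
        ((⟪(x : Space d), w⟫ : ℝ) * Complex.I) ^ k / (k.factorial : ℂ) := fun k => by fun_prop
    have hs := hasSum_integral_of_summable_integral_norm (μ := m)
      (F := fun (k : ℕ) (x : Sph d) => ((⟪(x : Space d), w⟫ : ℝ) * Complex.I) ^ k / (k.factorial : ℂ))
      (fun k => integrable_of_continuous (hc k)) ?_
    · have hexp : ∀ x : Sph d, ∑' k : ℕ, ((⟪(x : Space d), w⟫ : ℝ) * Complex.I) ^ k / (k.factorial : ℂ) =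
          Complex.exp ((⟪(x : Space d), w⟫ : ℝ) * Complex.I) := fun x => by
        rw [Complex.exp_eq_exp_ℂ, NormedSpace.exp_eq_tsum_div]
      simp only [hexp] at hs
      rw [charFun_apply, hemb.integral_map]
      refine Eq.subst (motive := fun f => HasSum f _) (funext fun k => ?_) hs
      rw [← integral_complex_ofReal, ← integral_const_mul]
      refine integral_congr_ae (ae_of_all _ fun x => ?_)
      simp only [mul_pow]
      push_cast
      ring
    · refine Summable.of_nonneg_of_le (fun k => integral_nonneg fun _ => norm_nonneg _) (fun k => ?_)
        ((Real.summable_pow_div_factorial ‖w‖).mul_left (m.real univ))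
      rw [← smul_eq_mul, ← integral_const]
      refine integral_mono (integrable_of_continuous (hc k)).norm (integrable_const _) fun x => ?_
      simp only [norm_div, norm_pow, norm_mul, Complex.norm_I, mul_one, Complex.norm_real,
        Real.norm_eq_abs, Complex.norm_natCast]
      gcongr
      exact hb x
  have hmap : μ.map Subtype.val = ν.map Subtype.val := by
    refine Measure.ext_of_charFun (funext fun w => ?_)
    have h1 := key μ w
    simp only [integral_inner_pow_eq μ ν h] at h1
    exact h1.unique (key ν w)
  rw [← hemb.comap_map μ, hmap, hemb.comap_map]

end Moments

/-! ### Positive definiteness and minimality of the uniform measure -/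

section Energy

/-- The Riesz kernel with one of its arguments moved off the sphere. -/
noncomputable def dilatedKernel (s R : ℝ) (x y : Space d) : ℝ := dist x (R • y) ^ (-s)

theorem dist_smul_sq (R : ℝ) {x y : Space d} (hx : ‖x‖ = 1) (hy : ‖y‖ = 1) :
    dist x (R • y) ^ 2 = 1 + R ^ 2 - 2 * R * ⟪x, y⟫ := by
  rw [dist_eq_norm, norm_sub_sq_real, inner_smul_right, norm_smul, hx, hy, mul_one,
    Real.norm_eq_abs, sq_abs]
  ring

theorem dist_smul_comm (R : ℝ) {x y : Space d} (hx : ‖x‖ = 1) (hy : ‖y‖ = 1) :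
    dist x (R • y) = dist y (R • x) := by
  refine (sq_eq_sq₀ dist_nonneg dist_nonneg).1 ?_
  rw [dist_smul_sq R hx hy, dist_smul_sq R hy hx, real_inner_comm]

/-- This form exhibits the kernel as a binomial series in `⟪x, y⟫`, with ratio `2R/(1 + R²) < 1`. -/
theorem dilatedKernel_eq (s : ℝ) {R : ℝ} (hR : 1 < R) {x y : Space d} (hx : ‖x‖ = 1)
    (hy : ‖y‖ = 1) : dilatedKernel s R x y =
      (1 + R ^ 2) ^ (-(s / 2)) * (1 - 2 * R / (1 + R ^ 2) * ⟪x, y⟫) ^ (-(s / 2)) := by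
  have h := dist_smul_sq R hx hy
  have hp := dist_smul_pos hR hy hx
  have h2 : dist x (R • y) ^ 2 = (1 + R ^ 2) * (1 - 2 * R / (1 + R ^ 2) * ⟪x, y⟫) := by
    rw [h]; field_simp
  have h3 : 0 ≤ 1 - 2 * R / (1 + R ^ 2) * ⟪x, y⟫ := by
    have : 0 < (1 + R ^ 2) * (1 - 2 * R / (1 + R ^ 2) * ⟪x, y⟫) := by rw [← h2]; positivity
    exact (pos_of_mul_pos_right this (by positivity)).le
  rw [← Real.mul_rpow (by positivity) h3, ← h2, dilatedKernel, ← Real.rpow_natCast,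
    ← Real.rpow_mul dist_nonneg]
  congr 1
  push_cast
  ring

theorem continuous_dilatedKernel (s : ℝ) {R : ℝ} (hR : 1 < R) :
    Continuous fun p : Sph d × Sph d => dilatedKernel s R (p.1 : Space d) (p.2 : Space d) := by
  unfold dilatedKernel
  refine Continuous.rpow_const (by fun_prop) fun p => Or.inl ?_
  exact (dist_smul_pos hR (norm_coe_sph p.2) (norm_coe_sph p.1)).ne'

theorem dilatedKernel_comm (s R : ℝ) (x y : Sph d) :
    dilatedKernel s R (x : Space d) y = dilatedKernel s R (y : Space d) x := by
  rw [dilatedKernel, dilatedKernel, dist_smul_comm R (norm_coe_sph x) (norm_coe_sph y)]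

/-- The dilated Riesz kernel is strictly positive definite on the sphere. -/
theorem exists_hasSum_dilatedKernel {s R : ℝ} (hs : 0 < s) (hR : 1 < R) :
    ∃ B : ℕ → ℝ, (∀ k, 0 < B k) ∧
      ∀ (μ ν : Measure (Sph d)) [IsFiniteMeasure μ] [IsFiniteMeasure ν],
        HasSum (fun k => B k * momentDefect μ ν k)
          (pairing μ μ (dilatedKernel s R) - 2 * pairing μ ν (dilatedKernel s R) +
            pairing ν ν (dilatedKernel s R)) := by
  obtain ⟨A, hA, hF⟩ := exists_pos_hasSum_one_sub_rpow_neg (half_pos hs)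
  set z := 2 * R / (1 + R ^ 2) with hz
  have hz0 : 0 < z := by positivity
  have hz1 : z < 1 := by rw [hz, div_lt_one (by positivity)]; nlinarith
  refine ⟨fun k => (1 + R ^ 2) ^ (-(s / 2)) * (A k * z ^ k), fun k => ?_, fun μ ν _ _ => ?_⟩
  · have := hA k
    positivity
  · have hp : ∀ (μ ν : Measure (Sph d)), pairing μ ν (dilatedKernel s R) =
        (1 + R ^ 2) ^ (-(s / 2)) * pairing μ ν fun x y => (1 - z * ⟪x, y⟫) ^ (-(s / 2)) := by
      intro μ ν
      rw [pairing, pairing, ← integral_const_mul]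
      exact integral_congr_ae (ae_of_all _ fun p =>
        dilatedKernel_eq s hR (norm_coe_sph p.1) (norm_coe_sph p.2))
    have h := (hasSum_momentDefect μ ν hA hF hz0.le hz1).mul_left ((1 + R ^ 2) ^ (-(s / 2)))
    rw [hp, hp, hp]
    convert h using 1
    · rfl
    · funext k; ring
    · ring

theorem pairing_dilatedKernel (s : ℝ) {R : ℝ} (hR : 1 < R) (μ ν : Measure (Sph d))
    [IsFiniteMeasure μ] [IsFiniteMeasure ν] : pairing μ ν (dilatedKernel s R) =
      ∫ x : Sph d, ∫ y : Sph d, dilatedKernel s R (x : Space d) (y : Space d) ∂ν ∂μ :=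
  integral_prod _ (integrable_of_continuous (continuous_dilatedKernel s hR))

theorem rieszKernel_smul_toReal (s R : ℝ) (x y : Sph d) :
    (rieszKernel s (R • (y : Space d)) (x : Space d)).toReal = dilatedKernel s R (x : Space d) y := by
  rw [rieszKernel_toReal, dist_comm, dilatedKernel]

theorem rieszKernel_smul_eq (s : ℝ) {R : ℝ} (hR : 1 < R) (x y : Sph d) :
    rieszKernel s (R • (y : Space d)) (x : Space d) =
      ENNReal.ofReal (dilatedKernel s R (x : Space d) y) := by
  rw [rieszKernel_of_ne s (dist_pos.1 ?_), dist_comm, dilatedKernel]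
  rw [dist_comm]
  exact dist_smul_pos hR (norm_coe_sph y) (norm_coe_sph x)

theorem integral_dilatedKernel (s R : ℝ) (hR : 1 < R) (μ : Measure (Sph d)) (y : Sph d) :
    ∫ x : Sph d, dilatedKernel s R (x : Space d) y ∂μ =
      (rieszPotential s μ (R • (y : Space d))).toReal := by
  have hm : Measurable fun x : Sph d => rieszKernel s (R • (y : Space d)) (x : Space d) :=
    (measurable_rieszKernel s _).comp measurable_subtype_coe
  simp only [← rieszKernel_smul_toReal]
  rw [integral_toReal hm.aemeasurable (ae_of_all _ fun x => ?_), rieszPotential]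
  rw [rieszKernel_smul_eq s hR]
  exact ENNReal.ofReal_lt_top

/-- Finite measures with the same potential on a larger concentric sphere agree. -/
theorem measure_eq_of_rieszPotential_eq {s R : ℝ} (hs : 0 < s) (hR : 1 < R)
    (μ ν : Measure (Sph d)) [IsFiniteMeasure μ] [IsFiniteMeasure ν]
    (h : ∀ y : Sph d, rieszPotential s μ (R • (y : Space d)) =
      rieszPotential s ν (R • (y : Space d))) : μ = ν := by
  obtain ⟨B, hB, hsum⟩ := exists_hasSum_dilatedKernel (d := d) hs hR
  refine measure_eq_of_momentDefect_eq_zero μ ν fun k => ?_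
  -- Equal potentials make `μ` and `ν` pair equally with every measure, so the energy of `μ - ν`
  -- vanishes; all its nonnegative terms are then zero.
  have hpair : ∀ (m : Measure (Sph d)) [IsFiniteMeasure m],
      pairing m μ (dilatedKernel s R) = pairing m ν (dilatedKernel s R) := by
    intro m _
    rw [pairing_dilatedKernel s hR, pairing_dilatedKernel s hR]
    refine integral_congr_ae (ae_of_all _ fun x => ?_)
    simp only [dilatedKernel_comm s R x, integral_dilatedKernel s R hR, h]
  have h0 := hsum μ ν
  rw [hpair μ, pairing_comm μ ν fun x y => dilatedKernel_comm s R x y, hpair ν] at h0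
  have h1 : HasSum (fun k => B k * momentDefect μ ν k) 0 := by
    convert h0 using 1; ring
  have := (hasSum_zero_iff_of_nonneg fun k =>
    mul_nonneg (hB k).le (momentDefect_nonneg μ ν k)).1 h1
  exact (mul_eq_zero.1 (congrFun this k)).resolve_left (hB k).ne'

theorem rieszEnergy_sigma (s : ℝ) : rieszEnergy s (sigma d) = uniformConst d s := by
  have : ∀ x : Sph d, rieszPotential s (sigma d) (x : Space d) = uniformConst d s :=
    fun x => rieszPotential_sigma_sph s (norm_coe_sph x)
  simp [rieszEnergy, this]

/-- For the dilated kernel every probability measure pairs with `σ_d` to `U(R)`, so nonnegativity of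
the energy of `μ - σ_d` bounds the dilated energy of `μ` below by `U(R)`. The dilated kernel is
itself at most the Riesz kernel. -/
theorem uniformPotential_le_rieszEnergy {s R : ℝ} (hs : 0 < s) (hR : 1 < R)
    (μ : Measure (Sph d)) [IsProbabilityMeasure μ] :
    ENNReal.ofReal (uniformPotential d s R) ≤ rieszEnergy s μ := by
  obtain ⟨B, hB, hsum⟩ := exists_hasSum_dilatedKernel (d := d) hs hR
  have hσ : ∀ (m : Measure (Sph d)) [IsProbabilityMeasure m],
      pairing m (sigma d) (dilatedKernel s R) = uniformPotential d s R := by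
    intro m _
    have : ∀ x : Sph d, rieszPotential s (sigma d) (R • (x : Space d)) =
        rieszPotential s (sigma d) (source d R) :=
      fun x => rieszPotential_sigma_smul s R (norm_coe_sph x)
    rw [pairing_dilatedKernel s hR]
    have h2 : ∀ x : Sph d, ∫ y : Sph d, dilatedKernel s R (x : Space d) y ∂(sigma d) =
        uniformPotential d s R := by
      intro x
      simp only [dilatedKernel_comm s R x, integral_dilatedKernel s R hR, this, uniformPotential]
    simp [h2]
  have h1 := (hsum μ (sigma d)).nonneg fun k =>
    mul_nonneg (hB k).le (momentDefect_nonneg μ (sigma d) k)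
  rw [hσ μ, hσ (sigma d)] at h1
  have h2 : uniformPotential d s R ≤ pairing μ μ (dilatedKernel s R) := by linarith
  refine (ENNReal.ofReal_le_ofReal h2).trans ?_
  have hc := continuous_dilatedKernel (d := d) s hR
  rw [pairing, ofReal_integral_eq_lintegral_ofReal (integrable_of_continuous hc)
    (ae_of_all _ fun p => Real.rpow_nonneg dist_nonneg _),
    lintegral_prod _ hc.measurable.ennreal_ofReal.aemeasurable]
  refine lintegral_mono fun x => lintegral_mono fun y => ?_
  change ENNReal.ofReal (dilatedKernel s R (x : Space d) y) ≤ rieszKernel s (x : Space d) y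
  rw [dilatedKernel_comm, ← rieszKernel_smul_eq s hR]
  exact rieszKernel_smul_le hs hR.le (norm_coe_sph x) (norm_coe_sph y)

/-- The uniform measure minimizes the energy. -/
theorem uniformConst_le_rieszEnergy {s : ℝ} (hs : 0 < s) (hsd : s < d)
    (μ : Measure (Sph d)) [IsProbabilityMeasure μ] : uniformConst d s ≤ rieszEnergy s μ := by
  have ht : Filter.Tendsto (fun R => ENNReal.ofReal (uniformPotential d s R))
      (nhdsWithin 1 (Ioi 1)) (nhds (ENNReal.ofReal (uniformPotential d s 1))) :=
    (ENNReal.continuous_ofReal.tendsto _).comp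
      ((continuousOn_uniformPotential hs hsd 1 self_mem_Ici).mono_left
        (nhdsWithin_mono _ Ioi_subset_Ici_self))
  rw [uniformPotential_one, ENNReal.ofReal_toReal (uniformConst_lt_top hs hsd).ne] at ht
  refine le_of_tendsto ht ?_
  filter_upwards [self_mem_nhdsWithin] with R hR
  exact uniformPotential_le_rieszEnergy hs hR μ

theorem sphereEnergy_eq {s : ℝ} (hs : 0 < s) (hsd : s < d) :
    sphereEnergy d s = (uniformConst d s).toReal := by
  rw [sphereEnergy]
  congr 1
  refine le_antisymm ?_ (le_iInf fun μ => uniformConst_le_rieszEnergy hs hsd (μ : Measure (Sph d)))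
  refine (iInf_le _ (⟨sigma d, inferInstance⟩ : ProbabilityMeasure (Sph d))).trans ?_
  exact (rieszEnergy_sigma s).le

theorem sphereEnergy_pos {s : ℝ} (hs : 0 < s) (hsd : s < d) : 0 < sphereEnergy d s := by
  rw [sphereEnergy_eq hs hsd]
  exact ENNReal.toReal_pos (uniformConst_pos hs).ne' (uniformConst_lt_top hs hsd).ne

end Energy

/-! ### Uniqueness of the signed equilibrium -/

section Uniqueness

variable {s R : ℝ}

theorem measurable_rieszKernel_coe (s : ℝ) (x : Space d) :
    Measurable fun y : Sph d => rieszKernel s x (y : Space d) :=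
  (measurable_rieszKernel s x).comp measurable_subtype_coe

theorem measurable_balayageDensity_coe (s R : ℝ) (e : Space d) :
    Measurable fun y : Sph d => balayageDensity s R e (y : Space d) :=
  (measurable_balayageDensity s R e).comp measurable_subtype_coe

theorem lintegral_rieszPotential_mul (s : ℝ) (μ : Measure (Sph d)) [IsFiniteMeasure μ]
    {w : Sph d → ℝ≥0∞} (hw : Measurable w) :
    ∫⁻ x : Sph d, rieszPotential s μ (x : Space d) * w x ∂(sigma d) =
      ∫⁻ y : Sph d, (∫⁻ x : Sph d, rieszKernel s (y : Space d) (x : Space d) * w x ∂(sigma d)) ∂μ := by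
  have hk : Measurable fun p : Sph d × Sph d => rieszKernel s (p.1 : Space d) (p.2 : Space d) := by
    unfold rieszKernel; fun_prop
  have hkw : Measurable (Function.uncurry fun x y : Sph d =>
      rieszKernel s (x : Space d) (y : Space d) * w x) := hk.mul (hw.comp measurable_fst)
  have h1 : ∀ x : Sph d, rieszPotential s μ (x : Space d) * w x =
      ∫⁻ y : Sph d, rieszKernel s (x : Space d) (y : Space d) * w x ∂μ := fun x => by
    rw [lintegral_mul_const _ (measurable_rieszKernel_coe s _), rieszPotential]
  simp only [h1]
  rw [lintegral_lintegral_swap hkw.aemeasurable]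
  refine lintegral_congr fun y => lintegral_congr fun x => ?_
  rw [rieszKernel_comm]

theorem lintegral_rieszPotential_sigma (s : ℝ) (μ : Measure (Sph d)) [IsFiniteMeasure μ] :
    ∫⁻ x : Sph d, rieszPotential s μ (x : Space d) ∂(sigma d) = uniformConst d s * μ univ := by
  have h := lintegral_rieszPotential_mul s μ (w := fun _ => 1) measurable_const
  simp only [mul_one] at h
  rw [h, ← lintegral_const]
  exact lintegral_congr fun y => rieszPotential_sigma_sph s (norm_coe_sph y)

/-- Fubini and the balayage identity: the potential at an exterior point is recovered from its
values on the sphere. -/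
theorem lintegral_rieszPotential_mul_balayageDensity (s : ℝ) (hR : 1 < R) (μ : Measure (Sph d))
    [IsFiniteMeasure μ] {e : Space d} (he : ‖e‖ = 1) :
    ∫⁻ x : Sph d, rieszPotential s μ (x : Space d) *
      ENNReal.ofReal (balayageDensity s R e (x : Space d)) ∂(sigma d) =
        uniformConst d s * rieszPotential s μ (R • e) := by
  rw [lintegral_rieszPotential_mul s μ
    (measurable_balayageDensity_coe s R e).ennreal_ofReal]
  have h : ∀ y : Sph d, ∫⁻ x : Sph d, rieszKernel s (y : Space d) (x : Space d) *
      ENNReal.ofReal (balayageDensity s R e (x : Space d)) ∂(sigma d) =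
      uniformConst d s * rieszKernel s (R • e) (y : Space d) := fun y => by
    rw [lintegral_rieszKernel_mul_balayageDensity s hR he (norm_coe_sph y), rieszKernel_comm]
  simp only [h]
  rw [lintegral_const_mul _ (measurable_rieszKernel_coe s _),
    rieszPotential]

/-- Finite measures on the sphere with the same potential on the sphere agree. -/
theorem measure_eq_of_rieszPotential_sph_eq (hs : 0 < s) (hsd : s < d)
    (μ ν : Measure (Sph d)) [IsFiniteMeasure μ] [IsFiniteMeasure ν]
    (h : ∀ x : Sph d, rieszPotential s μ (x : Space d) = rieszPotential s ν (x : Space d)) :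
    μ = ν := by
  -- Any radius greater than `1` would serve; `2` is arbitrary.
  refine measure_eq_of_rieszPotential_eq hs one_lt_two μ ν fun y => ?_
  have h1 := lintegral_rieszPotential_mul_balayageDensity s one_lt_two μ (norm_coe_sph y)
  have h2 := lintegral_rieszPotential_mul_balayageDensity s one_lt_two ν (norm_coe_sph y)
  simp only [h] at h1
  rw [h1] at h2
  exact (ENNReal.mul_right_inj (uniformConst_pos hs).ne' (uniformConst_lt_top hs hsd).ne).1 h2

/-- Averaging a potential over `σ_d` gives a constant times the total mass, so equal masses force `C
= 0`. -/
theorem rieszPotential_sph_eq_of_add_const (hs : 0 < s) (hsd : s < d)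
    (μ ν : Measure (Sph d)) [IsFiniteMeasure μ] [IsFiniteMeasure ν] (hm : μ univ = ν univ)
    {C : ℝ≥0∞} (h : ∀ x : Sph d, rieszPotential s μ (x : Space d) =
      rieszPotential s ν (x : Space d) + C) : μ = ν := by
  have h1 := lintegral_rieszPotential_sigma s μ
  simp only [h] at h1
  rw [lintegral_add_right _ measurable_const, lintegral_rieszPotential_sigma, lintegral_const,
    measure_univ (μ := sigma d), mul_one, hm] at h1
  have hC : C = 0 := by
    have hfin : uniformConst d s * ν univ ≠ ∞ :=
      (ENNReal.mul_lt_top (uniformConst_lt_top hs hsd) (measure_lt_top ν _)).ne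
    exact (ENNReal.add_right_inj hfin).1 (h1.trans (add_zero _).symm)
  exact measure_eq_of_rieszPotential_sph_eq hs hsd μ ν fun x => by rw [h, hC, add_zero]

theorem rieszPotential_add (s : ℝ) (μ ν : Measure (Sph d)) (x : Space d) :
    rieszPotential s (μ + ν) x = rieszPotential s μ x + rieszPotential s ν x :=
  lintegral_add_measure _ _ _

/-- With Jordan parts `p_i` and `n_i`, the positive measures `p₁ + n₂` and `p₂ + n₁` have equal
mass, and their potentials differ by a constant because the field cancels. -/
theorem IsSignedEquilibrium.unique {q : ℝ} (hs : 0 < s) (hsd : s < d)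
    {η₁ η₂ : SignedMeasure (Sph d)} (h₁ : IsSignedEquilibrium d s q R η₁)
    (h₂ : IsSignedEquilibrium d s q R η₂) : η₁ = η₂ := by
  obtain ⟨m₁, f₁, G₁, c₁⟩ := h₁
  obtain ⟨m₂, f₂, G₂, c₂⟩ := h₂
  rw [SignedMeasure.apply_eq_posPart_real_sub_negPart_real _ .univ] at m₁ m₂
  simp only [SignedMeasure.totalVariation, rieszPotential_add, ENNReal.add_lt_top] at f₁ f₂
  simp only [signedPotential] at c₁ c₂
  have e₁ := SignedMeasure.toSignedMeasure_toJordanDecomposition η₁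
  have e₂ := SignedMeasure.toSignedMeasure_toJordanDecomposition η₂
  rw [JordanDecomposition.toSignedMeasure] at e₁ e₂
  set p₁ := η₁.toJordanDecomposition.posPart
  set n₁ := η₁.toJordanDecomposition.negPart
  set p₂ := η₂.toJordanDecomposition.posPart
  set n₂ := η₂.toJordanDecomposition.negPart
  have hmass : (p₁ + n₂) univ = (p₂ + n₁) univ := by
    rw [← measureReal_eq_measureReal_iff, measureReal_add_apply, measureReal_add_apply]
    linarith
  have key : p₁ + n₂ = p₂ + n₁ := by
    -- Potentials take values in `ℝ≥0∞`, so the difference of the two constants goes on the side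
    -- where it is nonnegative.
    rcases le_total G₂ G₁ with hG | hG
    · refine rieszPotential_sph_eq_of_add_const hs hsd _ _ hmass (C := ENNReal.ofReal (G₁ - G₂))
        fun x => ?_
      have a₁ := c₁ x
      have a₂ := c₂ x
      rw [rieszPotential_add, rieszPotential_add,
        ← ENNReal.ofReal_toReal (f₁ x).1.ne, ← ENNReal.ofReal_toReal (f₁ x).2.ne,
        ← ENNReal.ofReal_toReal (f₂ x).1.ne, ← ENNReal.ofReal_toReal (f₂ x).2.ne,
        ← ENNReal.ofReal_add (by positivity) (by positivity),
        ← ENNReal.ofReal_add (by positivity) (by positivity),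
        ← ENNReal.ofReal_add (by positivity) (by linarith)]
      congr 1
      linarith
    · refine (rieszPotential_sph_eq_of_add_const hs hsd _ _ hmass.symm
        (C := ENNReal.ofReal (G₂ - G₁)) fun x => ?_).symm
      have a₁ := c₁ x
      have a₂ := c₂ x
      rw [rieszPotential_add, rieszPotential_add,
        ← ENNReal.ofReal_toReal (f₁ x).1.ne, ← ENNReal.ofReal_toReal (f₁ x).2.ne,
        ← ENNReal.ofReal_toReal (f₂ x).1.ne, ← ENNReal.ofReal_toReal (f₂ x).2.ne,
        ← ENNReal.ofReal_add (by positivity) (by positivity),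
        ← ENNReal.ofReal_add (by positivity) (by positivity),
        ← ENNReal.ofReal_add (by positivity) (by linarith)]
      congr 1
      linarith
  ext i hi
  rw [SignedMeasure.apply_eq_posPart_real_sub_negPart_real _ hi,
    SignedMeasure.apply_eq_posPart_real_sub_negPart_real _ hi]
  have h := congrArg (fun m : Measure (Sph d) => m.real i) key
  rw [measureReal_add_apply, measureReal_add_apply] at h
  change p₁.real i - n₁.real i = p₂.real i - n₂.real i
  linarith

end Uniqueness

/-! ### The explicit signed equilibrium -/

section Existence

variable {s q R : ℝ}

/-- The density of the signed equilibrium with respect to the uniform measure. -/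
noncomputable def equilibriumDensity (d : ℕ) (s q R : ℝ) (x : Space d) : ℝ :=
  1 + q / sphereEnergy d s * (uniformPotential d s R - balayageDensity s R (source d 1) x)

theorem norm_source_one : ‖source d 1‖ = 1 := by simp [norm_source]

theorem continuous_balayageDensity (s : ℝ) (hR : 1 < R) :
    Continuous fun x : Sph d => balayageDensity s R (source d 1) (x : Space d) := by
  unfold balayageDensity
  refine continuous_const.mul (Continuous.rpow_const (by fun_prop) fun x => Or.inl ?_)
  exact (dist_smul_pos hR norm_source_one (norm_coe_sph x)).ne'

theorem continuous_equilibriumDensity (s q : ℝ) (hR : 1 < R) :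
    Continuous fun x : Sph d => equilibriumDensity d s q R (x : Space d) := by
  have := continuous_balayageDensity (d := d) s hR
  unfold equilibriumDensity
  fun_prop

theorem integral_equilibriumDensity (hs : 0 < s) (hsd : s < d) (hR : 1 < R) :
    ∫ x : Sph d, equilibriumDensity d s q R (x : Space d) ∂(sigma d) = 1 := by
  have hi := integrable_balayageDensity (d := d) hs hsd hR norm_source_one
  have hm := integral_balayageDensity (d := d) hs hsd hR norm_source_one
  simp only [equilibriumDensity]
  have hi2 : Integrable (fun y : Sph d => uniformPotential d s R -
      balayageDensity s R (source d 1) (y : Space d)) (sigma d) := (integrable_const _).sub hi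
  rw [integral_add (integrable_const _) (hi2.const_mul _), integral_const_mul,
    integral_sub (integrable_const _) hi, hm]
  simp

/-- The signed equilibrium. -/
noncomputable def equilibrium (d : ℕ) (s q R : ℝ) : SignedMeasure (Sph d) :=
  (sigma d).withDensityᵥ fun x => equilibriumDensity d s q R (x : Space d)

theorem equilibrium_apply (s q : ℝ) (hR : 1 < R) {i : Set (Sph d)} (hi : MeasurableSet i) :
    equilibrium d s q R i = ∫ x in i, equilibriumDensity d s q R (x : Space d) ∂(sigma d) :=
  withDensityᵥ_apply (integrable_of_continuous (continuous_equilibriumDensity s q hR)) hi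

/-- The positive and negative parts of the density give mutually singular measures, and the Jordan
decomposition is unique. -/
theorem toJordanDecomposition_withDensity {X : Type*} [MeasurableSpace X] {μ : Measure X}
    {f : X → ℝ} (hf : Measurable f) (hfi : Integrable f μ) :
    (SignedMeasure.toJordanDecomposition (μ.withDensityᵥ f)).posPart =
        μ.withDensity (fun x => ENNReal.ofReal (f x)) ∧
      (SignedMeasure.toJordanDecomposition (μ.withDensityᵥ f)).negPart =
        μ.withDensity (fun x => ENNReal.ofReal (-f x)) := by
  have h1 := isFiniteMeasure_withDensity_ofReal hfi.2
  have h2 := isFiniteMeasure_withDensity_ofReal hfi.neg.2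
  have h := SignedMeasure.toJordanDecomposition_eq (s := μ.withDensityᵥ f)
    (j := ⟨μ.withDensity fun x => ENNReal.ofReal (f x), μ.withDensity fun x => ENNReal.ofReal (-f x),
      withDensity_ofReal_mutuallySingular hf⟩)
    (withDensityᵥ_eq_withDensity_pos_part_sub_withDensity_neg_part hfi)
  rw [h]
  exact ⟨rfl, rfl⟩

theorem rieszPotential_withDensity (s : ℝ) {f : Sph d → ℝ} (hf : Measurable f) (x : Space d) :
    rieszPotential s ((sigma d).withDensity fun y => ENNReal.ofReal (f y)) x =
      ∫⁻ y : Sph d, rieszKernel s x (y : Space d) * ENNReal.ofReal (f y) ∂(sigma d) := by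
  rw [rieszPotential, lintegral_withDensity_eq_lintegral_mul _ (by fun_prop)
    (measurable_rieszKernel_coe s x)]
  exact lintegral_congr fun y => mul_comm _ _

theorem rieszPotential_withDensity_lt_top (hs : 0 < s) (hsd : s < d) {f : Sph d → ℝ}
    (hf : Continuous f) (x : Sph d) :
    rieszPotential s ((sigma d).withDensity fun y => ENNReal.ofReal (f y)) (x : Space d) < ∞ := by
  rw [rieszPotential_withDensity s hf.measurable]
  obtain ⟨C, hC⟩ := isCompact_univ.exists_bound_of_continuousOn hf.continuousOn
  calc _ ≤ ∫⁻ y : Sph d, rieszKernel s (x : Space d) (y : Space d) * ENNReal.ofReal C ∂(sigma d) := by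
        gcongr with y
        exact (le_abs_self _).trans (hC y (mem_univ y))
    _ = uniformConst d s * ENNReal.ofReal C := by
        rw [lintegral_mul_const' _ _ ENNReal.ofReal_ne_top, ← rieszPotential,
          rieszPotential_sigma_sph s (norm_coe_sph x)]
    _ < ∞ := ENNReal.mul_lt_top (uniformConst_lt_top hs hsd) ENNReal.ofReal_lt_top

theorem integrable_rieszKernel (hs : 0 < s) (hsd : s < d) (x : Sph d) :
    Integrable (fun y : Sph d => (rieszKernel s (x : Space d) (y : Space d)).toReal) (sigma d) := by
  refine integrable_toReal_of_lintegral_ne_top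
    (measurable_rieszKernel_coe s _).aemeasurable ?_
  rw [← rieszPotential, rieszPotential_sigma_sph s (norm_coe_sph x)]
  exact (uniformConst_lt_top hs hsd).ne

theorem signedPotential_withDensity (hs : 0 < s) (hsd : s < d) {f : Sph d → ℝ}
    (hf : Continuous f) (x : Sph d) :
    signedPotential s ((sigma d).withDensityᵥ f) (x : Space d) =
      ∫ y : Sph d, (rieszKernel s (x : Space d) (y : Space d)).toReal * f y ∂(sigma d) := by
  have hd : d ≠ 0 := by rintro rfl; simp at hsd; linarith
  obtain ⟨h1, h2⟩ := toJordanDecomposition_withDensity hf.measurable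
    (integrable_of_continuous (μ := sigma d) hf)
  obtain ⟨C, hC⟩ := isCompact_univ.exists_bound_of_continuousOn hf.continuousOn
  have hint : Integrable (fun y : Sph d =>
      (rieszKernel s (x : Space d) (y : Space d)).toReal * f y) (sigma d) :=
    (integrable_rieszKernel hs hsd x).mul_bdd (c := C) hf.aestronglyMeasurable
      (ae_of_all _ fun y => hC y (mem_univ y))
  have hk : ∀ᵐ y : Sph d ∂(sigma d), ∀ a : ℝ,
      ENNReal.ofReal ((rieszKernel s (x : Space d) (y : Space d)).toReal * a) =
        rieszKernel s (x : Space d) (y : Space d) * ENNReal.ofReal a := by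
    filter_upwards [ae_sigma_ne hd (norm_coe_sph x)] with y hy a
    rw [ENNReal.ofReal_mul ENNReal.toReal_nonneg, ENNReal.ofReal_toReal]
    rw [rieszKernel_of_ne s hy]
    exact ENNReal.ofReal_ne_top
  rw [signedPotential, h1, h2, rieszPotential_withDensity s hf.measurable,
    rieszPotential_withDensity s (f := fun x => -f x) hf.neg.measurable,
    integral_eq_lintegral_pos_part_sub_lintegral_neg_part hint]
  congr 2
  · exact lintegral_congr_ae (hk.mono fun y hy => (hy _).symm)
  · refine lintegral_congr_ae (hk.mono fun y hy => ?_)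
    simp only [← mul_neg]
    exact (hy _).symm

theorem integral_rieszKernel_mul_balayageDensity (hs : 0 < s) (hsd : s < d) (hR : 1 < R)
    (x : Sph d) :
    ∫ y : Sph d, (rieszKernel s (x : Space d) (y : Space d)).toReal *
      balayageDensity s R (source d 1) (y : Space d) ∂(sigma d) =
        sphereEnergy d s * dist (x : Space d) (source d R) ^ (-s) := by
  have h := lintegral_rieszKernel_mul_balayageDensity s hR norm_source_one (norm_coe_sph x)
  have hlt : uniformConst d s * rieszKernel s (x : Space d) (R • source d 1) < ∞ := by
    refine ENNReal.mul_lt_top (uniformConst_lt_top hs hsd) ?_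
    rw [rieszKernel_of_ne s (dist_pos.1 (dist_smul_pos hR norm_source_one (norm_coe_sph x)))]
    exact ENNReal.ofReal_lt_top
  have hm : Measurable fun y : Sph d => rieszKernel s (x : Space d) (y : Space d) *
      ENNReal.ofReal (balayageDensity s R (source d 1) (y : Space d)) :=
    (measurable_rieszKernel_coe s _).mul
      (measurable_balayageDensity_coe s R _).ennreal_ofReal
  have h2 := integral_toReal hm.aemeasurable (ae_lt_top hm (by rw [h]; exact hlt.ne))
  rw [h, ENNReal.toReal_mul, rieszKernel_toReal, ← sphereEnergy_eq hs hsd, ← source_eq_smul] at h2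
  rw [← h2]
  refine integral_congr_ae (ae_of_all _ fun y => ?_)
  simp only [ENNReal.toReal_mul]
  rw [ENNReal.toReal_ofReal (balayageDensity_pos s hR norm_source_one (norm_coe_sph y)).le]

/-- On the sphere the constant density `1` has potential `W` and the balayage density has potential
`W |x - a|^(-s)`. The latter term cancels the field and leaves the constant `W + q U(R)`. -/
theorem isSignedEquilibrium_equilibrium (q : ℝ) (hs : 0 < s) (hsd : s < d) (hR : 1 < R) :
    IsSignedEquilibrium d s q R (equilibrium d s q R) := by
  have hW := (sphereEnergy_pos hs hsd).ne'
  have hc := continuous_equilibriumDensity (d := d) s q hR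
  refine ⟨?_, fun x => ?_, sphereEnergy d s + q * uniformPotential d s R, fun x => ?_⟩
  · rw [equilibrium_apply s q hR .univ, setIntegral_univ, integral_equilibriumDensity hs hsd hR]
  · obtain ⟨h1, h2⟩ := toJordanDecomposition_withDensity hc.measurable
      (integrable_of_continuous (μ := sigma d) hc)
    rw [SignedMeasure.totalVariation, rieszPotential_add, equilibrium, h1, h2]
    exact ENNReal.add_lt_top.2 ⟨rieszPotential_withDensity_lt_top hs hsd hc x,
      rieszPotential_withDensity_lt_top hs hsd hc.neg x⟩
  · have hk := integrable_rieszKernel hs hsd x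
    have hb := continuous_balayageDensity (d := d) s hR
    obtain ⟨C, hC⟩ := isCompact_univ.exists_bound_of_continuousOn hb.continuousOn
    have hkb : Integrable (fun y : Sph d => (rieszKernel s (x : Space d) (y : Space d)).toReal *
        balayageDensity s R (source d 1) (y : Space d)) (sigma d) :=
      hk.mul_bdd (c := C) hb.aestronglyMeasurable (ae_of_all _ fun y => hC y (mem_univ y))
    have hsplit : ∀ y : Sph d, (rieszKernel s (x : Space d) (y : Space d)).toReal *
        equilibriumDensity d s q R (y : Space d) =
        (1 + q / sphereEnergy d s * uniformPotential d s R) *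
          (rieszKernel s (x : Space d) (y : Space d)).toReal - q / sphereEnergy d s *
          ((rieszKernel s (x : Space d) (y : Space d)).toReal *
            balayageDensity s R (source d 1) (y : Space d)) := fun y => by
      rw [equilibriumDensity]; ring
    have hpot : ∫ y : Sph d, (rieszKernel s (x : Space d) (y : Space d)).toReal ∂(sigma d) =
        sphereEnergy d s := by
      rw [integral_toReal (measurable_rieszKernel_coe s _).aemeasurable,
        ← rieszPotential, rieszPotential_sigma_sph s (norm_coe_sph x), sphereEnergy_eq hs hsd]
      refine ae_lt_top (measurable_rieszKernel_coe s _) ?_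
      rw [← rieszPotential, rieszPotential_sigma_sph s (norm_coe_sph x)]
      exact (uniformConst_lt_top hs hsd).ne
    rw [equilibrium, signedPotential_withDensity hs hsd hc, externalField]
    simp only [hsplit]
    rw [integral_sub (hk.const_mul _) (hkb.const_mul _), integral_const_mul, integral_const_mul,
      hpot, integral_rieszKernel_mul_balayageDensity hs hsd hR, Real.rpow_neg dist_nonneg]
    field_simp
    ring

end Existence

/-! ### Positivity is decided at the pole opposite to the charge -/

section Positivity

variable {s q R : ℝ}

/-- The function of the distance whose level sets are the critical distances. -/
noncomputable def criticalFunction (d : ℕ) (s R : ℝ) : ℝ :=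
  uniformPotential d s R - (R - 1) ^ ((d : ℝ) - s) / (R + 1) ^ d

theorem dist_south (hR : 1 < R) : dist (-source d 1) (R • source d 1) = R + 1 := by
  rw [dist_eq_norm, show -source d 1 - R • source d 1 = (-(R + 1)) • source d 1 by module,
    norm_smul, norm_source_one, mul_one, Real.norm_eq_abs, abs_neg, abs_of_pos (by linarith)]

theorem balayageDensity_south (s : ℝ) (hR : 1 < R) :
    balayageDensity s R (source d 1) (-source d 1) =
      (R - 1) ^ ((d : ℝ) - s) / (R + 1) ^ d := by
  have h1 : 0 < R - 1 := by linarith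
  have h2 : 0 < R + 1 := by linarith
  rw [balayageDensity, dist_south hR, show R ^ 2 - 1 = (R - 1) * (R + 1) by ring,
    Real.mul_rpow h1.le h2.le, mul_assoc, ← Real.rpow_add h2, div_eq_mul_inv,
    ← Real.rpow_natCast (R + 1) d, ← Real.rpow_neg h2.le]
  congr 2
  ring

theorem equilibriumDensity_south (s q : ℝ) (hR : 1 < R) :
    equilibriumDensity d s q R (-source d 1) =
      1 + q / sphereEnergy d s * criticalFunction d s R := by
  rw [equilibriumDensity, balayageDensity_south s hR, criticalFunction]

theorem dist_smul_lt (hR : 1 < R) {x : Space d} (hx : ‖x‖ = 1) (hne : x ≠ -source d 1) :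
    dist x (R • source d 1) < R + 1 := by
  have h := dist_smul_sq R hx (norm_source_one (d := d))
  have h2 : 0 < 2 + 2 * ⟪x, source d 1⟫ := by
    have h3 : 0 < ‖x + source d 1‖ ^ 2 := by
      have : x + source d 1 ≠ 0 := fun h0 => hne (eq_neg_of_add_eq_zero_left h0)
      positivity
    rw [norm_add_sq_real, hx, norm_source_one] at h3
    linarith
  refine lt_of_pow_lt_pow_left₀ 2 (by linarith) ?_
  nlinarith

/-- The opposite pole is the unique farthest point from the charge and `s - 2d < 0`, so the balayage
density is smallest there; it enters with the positive factor `-q/W`. -/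
theorem equilibriumDensity_south_lt (hs : 0 < s) (hsd : s < d) (hq : q < 0) (hR : 1 < R)
    {x : Space d} (hx : ‖x‖ = 1) (hne : x ≠ -source d 1) :
    equilibriumDensity d s q R (-source d 1) < equilibriumDensity d s q R x := by
  have hW := sphereEnergy_pos hs hsd
  have hlt : balayageDensity s R (source d 1) (-source d 1) <
      balayageDensity s R (source d 1) x := by
    have hR1 : 0 < R ^ 2 - 1 := by nlinarith
    rw [balayageDensity, balayageDensity, dist_south hR]
    refine mul_lt_mul_of_pos_left ?_ (by positivity)
    exact Real.rpow_lt_rpow_of_neg (dist_smul_pos hR norm_source_one hx) (dist_smul_lt hR hx hne)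
      (by linarith)
  have hqW : q / sphereEnergy d s < 0 := div_neg_of_neg_of_pos hq hW
  rw [equilibriumDensity, equilibriumDensity]
  nlinarith

theorem norm_south : ‖-source d 1‖ = 1 := by rw [norm_neg, norm_source_one]

/-- The density may vanish at the pole, but only there, and a point is null for `σ_d`. The support
is therefore still the whole sphere in the borderline case, and the smallest distance is attained.
-/
theorem isPositiveOnSphere_equilibrium (hs : 0 < s) (hsd : s < d) (hq : q < 0) (hR : 1 < R)
    (h : 0 ≤ equilibriumDensity d s q R (-source d 1)) :
    IsPositiveOnSphere (equilibrium d s q R) := by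
  have hd : d ≠ 0 := by rintro rfl; simp at hsd; linarith
  have hc := continuous_equilibriumDensity (d := d) s q hR
  have hpos : ∀ x : Sph d, (x : Space d) ≠ -source d 1 →
      0 < equilibriumDensity d s q R (x : Space d) := fun x hx =>
    h.trans_lt (equilibriumDensity_south_lt hs hsd hq hR (norm_coe_sph x) hx)
  have hnn : ∀ x : Sph d, 0 ≤ equilibriumDensity d s q R (x : Space d) := fun x => by
    by_cases hx : (x : Space d) = -source d 1
    · rwa [hx]
    · exact (hpos x hx).le
  refine ⟨(VectorMeasure.le_iff).2 fun i hi => ?_, fun V hV hne => ?_⟩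
  · rw [equilibrium_apply s q hR hi]
    exact setIntegral_nonneg hi fun x _ => hnn x
  · rw [equilibrium_apply s q hR hV.measurableSet,
      setIntegral_pos_iff_support_of_nonneg_ae (ae_of_all _ hnn)
        (integrable_of_continuous hc).integrableOn]
    have h0 : sigma d {θ | (θ : Space d) = -source d 1} = 0 := sigma_singleton hd norm_south
    have hle : V \ {θ | (θ : Space d) = -source d 1} ⊆
        Function.support (fun x : Sph d => equilibriumDensity d s q R (x : Space d)) ∩ V :=
      fun x hx => ⟨(hpos x hx.2).ne', hx.1⟩
    refine lt_of_lt_of_le ?_ (measure_mono hle)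
    rw [measure_sdiff_null h0]
    exact hV.measure_pos _ hne

/-- A negative value at the pole persists on an open set by continuity, and `σ_d` charges open sets.
-/
theorem equilibriumDensity_south_nonneg_of_nonneg (hR : 1 < R)
    (h : 0 ≤ equilibrium d s q R) : 0 ≤ equilibriumDensity d s q R (-source d 1) := by
  by_contra! hlt
  have hc := continuous_equilibriumDensity (d := d) s q hR
  set V : Set (Sph d) := {x | equilibriumDensity d s q R (x : Space d) < 0}
  have hV : IsOpen V := isOpen_lt hc continuous_const
  have hne : V.Nonempty := ⟨⟨-source d 1, by simp [norm_source]⟩, hlt⟩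
  have h1 : 0 ≤ equilibrium d s q R V := by simpa using h V hV.measurableSet
  rw [equilibrium_apply s q hR hV.measurableSet] at h1
  have h2 : 0 < ∫ x in V, -equilibriumDensity d s q R (x : Space d) ∂(sigma d) := by
    rw [setIntegral_pos_iff_support_of_nonneg_ae
      ((ae_restrict_mem hV.measurableSet).mono fun x hx => neg_nonneg.2 (le_of_lt hx))
      (integrable_of_continuous hc.neg).integrableOn]
    refine lt_of_lt_of_le (hV.measure_pos (sigma d) hne) (measure_mono fun x hx => ⟨?_, hx⟩)
    exact neg_ne_zero.2 (ne_of_lt hx)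
  rw [integral_neg] at h2
  linarith

theorem equilibriumDensity_south_nonneg_iff (hs : 0 < s) (hsd : s < d) (hq : q < 0) (hR : 1 < R) :
    0 ≤ equilibriumDensity d s q R (-source d 1) ↔
      criticalFunction d s R ≤ -(sphereEnergy d s / q) := by
  have hW := sphereEnergy_pos hs hsd
  rw [equilibriumDensity_south s q hR]
  have h1 : 1 + q / sphereEnergy d s * criticalFunction d s R =
      (-q / sphereEnergy d s) * (-(sphereEnergy d s / q) - criticalFunction d s R) := by
    have hq0 := hq.ne
    field_simp
    ring
  rw [h1, mul_nonneg_iff_of_pos_left (div_pos (neg_pos.2 hq) hW), sub_nonneg]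

theorem IsSignedEquilibrium.isPositiveOnSphere_iff (hs : 0 < s) (hsd : s < d) (hq : q < 0)
    (hR : 1 < R) {η : SignedMeasure (Sph d)} (hη : IsSignedEquilibrium d s q R η) :
    IsPositiveOnSphere η ↔ criticalFunction d s R ≤ -(sphereEnergy d s / q) := by
  rw [hη.unique hs hsd (isSignedEquilibrium_equilibrium q hs hsd hR),
    ← equilibriumDensity_south_nonneg_iff hs hsd hq hR]
  exact ⟨fun h => equilibriumDensity_south_nonneg_of_nonneg hR h.1,
    isPositiveOnSphere_equilibrium hs hsd hq hR⟩

theorem IsSignedEquilibrium.nonneg_iff (hs : 0 < s) (hsd : s < d) (hq : q < 0)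
    (hR : 1 < R) {η : SignedMeasure (Sph d)} (hη : IsSignedEquilibrium d s q R η) :
    0 ≤ η ↔ criticalFunction d s R ≤ -(sphereEnergy d s / q) := by
  rw [hη.unique hs hsd (isSignedEquilibrium_equilibrium q hs hsd hR),
    ← equilibriumDensity_south_nonneg_iff hs hsd hq hR]
  exact ⟨fun h => equilibriumDensity_south_nonneg_of_nonneg hR h,
    fun h => (isPositiveOnSphere_equilibrium hs hsd hq hR h).1⟩

end Positivity

/-! ### Strict monotonicity and range of the critical function -/

section Monotonicity

variable {s : ℝ}

theorem dist_source_pos {R : ℝ} (hR : 1 < R) (θ : Sph d) : 0 < dist (source d R) (θ : Space d) := by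
  rw [source_eq_smul, dist_comm]
  exact dist_smul_pos hR norm_source_one (norm_coe_sph θ)

theorem dist_source_le {R : ℝ} (hR : 1 < R) (θ : Sph d) :
    dist (source d R) (θ : Space d) ≤ R + 1 := by
  refine (dist_le_norm_add_norm _ _).trans ?_
  rw [norm_source, norm_coe_sph, abs_of_pos (by linarith)]

/-- With `v = ⟪θ, source d 1⟫`, squaring and cross-multiplying leaves the difference `2 (1 + v) (R₂
- R₁) (R₁ R₂ - 1) ≥ 0`. -/
theorem div_dist_source_antitone {R₁ R₂ : ℝ} (h₁ : 1 < R₁) (h : R₁ ≤ R₂) (θ : Sph d) :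
    (R₂ + 1) / dist (source d R₂) (θ : Space d) ≤ (R₁ + 1) / dist (source d R₁) (θ : Space d) := by
  have h₂ : 1 < R₂ := h₁.trans_le h
  have p₁ := dist_source_pos (d := d) h₁ θ
  have p₂ := dist_source_pos (d := d) h₂ θ
  rw [div_le_div_iff₀ p₂ p₁]
  refine (sq_le_sq₀ (by positivity) (by positivity)).1 ?_
  have e₁ := dist_smul_sq R₁ (norm_coe_sph θ) (norm_source_one (d := d))
  have e₂ := dist_smul_sq R₂ (norm_coe_sph θ) (norm_source_one (d := d))
  rw [← source_eq_smul, dist_comm] at e₁ e₂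
  rw [mul_pow, mul_pow, e₁, e₂]
  have hv : -1 ≤ ⟪(θ : Space d), source d 1⟫ := by
    have := abs_real_inner_le_norm (θ : Space d) (source d 1)
    rw [norm_coe_sph, norm_source_one, one_mul] at this
    exact (abs_le.1 this).1
  have h3 : 0 ≤ (1 + ⟪(θ : Space d), source d 1⟫) * ((R₂ - R₁) * (R₁ * R₂ - 1)) :=
    mul_nonneg (by linarith) (mul_nonneg (by linarith) (by nlinarith))
  nlinarith

/-- The potential of the uniform measure relative to the potential of a charge at the point of the
sphere most distant from the source. -/
noncomputable def relativePotential (d : ℕ) (s R : ℝ) : ℝ :=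
  ∫ θ : Sph d, ((R + 1) / dist (source d R) (θ : Space d)) ^ s ∂(sigma d)

theorem integrable_div_dist_source {R : ℝ} (hR : 1 < R) :
    Integrable (fun θ : Sph d => ((R + 1) / dist (source d R) (θ : Space d)) ^ s) (sigma d) := by
  refine integrable_of_continuous (Continuous.rpow_const ?_ fun θ => Or.inl ?_)
  · exact continuous_const.div (by fun_prop) fun θ => (dist_source_pos hR θ).ne'
  · exact (div_pos (by linarith) (dist_source_pos hR θ)).ne'

theorem uniformPotential_eq_relativePotential (hs : 0 < s) (hsd : s < d) {R : ℝ} (hR : 1 < R) :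
    uniformPotential d s R = (R + 1) ^ (-s) * relativePotential d s R := by
  rw [uniformPotential_eq_integral hs hsd hR.le, relativePotential, ← integral_const_mul]
  refine integral_congr_ae (ae_of_all _ fun θ => ?_)
  have p := dist_source_pos hR θ
  have hR1 : 0 < R + 1 := by linarith
  simp only
  rw [Real.div_rpow hR1.le p.le, Real.rpow_neg p.le, Real.rpow_neg hR1.le]
  have := Real.rpow_pos_of_pos hR1 s
  field_simp

theorem relativePotential_antitone (hs : 0 < s) {R₁ R₂ : ℝ} (h₁ : 1 < R₁) (h : R₁ ≤ R₂) :
    relativePotential d s R₂ ≤ relativePotential d s R₁ := by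
  refine integral_mono (integrable_div_dist_source (h₁.trans_le h))
    (integrable_div_dist_source h₁) fun θ => ?_
  exact Real.rpow_le_rpow (div_nonneg (by linarith) dist_nonneg)
    (div_dist_source_antitone h₁ h θ) hs.le

theorem one_le_relativePotential (hs : 0 < s) {R : ℝ} (hR : 1 < R) :
    1 ≤ relativePotential d s R := by
  have h : ∫ _θ : Sph d, (1 : ℝ) ∂(sigma d) ≤ relativePotential d s R := by
    refine integral_mono (integrable_const _) (integrable_div_dist_source hR) fun θ => ?_
    exact Real.one_le_rpow ((one_le_div (dist_source_pos hR θ)).2 (dist_source_le hR θ)) hs.le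
  simpa using h

theorem criticalFunction_eq (hs : 0 < s) (hsd : s < d) {R : ℝ} (hR : 1 < R) :
    criticalFunction d s R = (R + 1) ^ (-s) *
      (relativePotential d s R - ((R - 1) / (R + 1)) ^ ((d : ℝ) - s)) := by
  have h1 : 0 < R - 1 := by linarith
  have h2 : 0 < R + 1 := by linarith
  rw [criticalFunction, uniformPotential_eq_relativePotential hs hsd hR, mul_sub,
    Real.div_rpow h1.le h2.le, Real.rpow_sub h2, Real.rpow_natCast, Real.rpow_neg h2.le]
  have := Real.rpow_pos_of_pos h2 s
  field_simp

/-- In the form `(R + 1)^(-s) * (J(R) - ((R - 1)/(R + 1))^(d-s))`, with `J` the relative potential,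
both factors decrease strictly. The second is nonnegative because `J ≥ 1` and the subtracted power
is at most `1`. -/
theorem strictAntiOn_criticalFunction (hs : 0 < s) (hsd : s < d) :
    StrictAntiOn (criticalFunction d s) (Ioi 1) := by
  intro R₁ h₁ R₂ h₂ h
  have h₁ : 1 < R₁ := h₁
  have h₂ : 1 < R₂ := h₂
  rw [criticalFunction_eq hs hsd h₁, criticalFunction_eq hs hsd h₂]
  have hds : 0 < (d : ℝ) - s := by linarith
  have hg : ((R₁ - 1) / (R₁ + 1)) ^ ((d : ℝ) - s) < ((R₂ - 1) / (R₂ + 1)) ^ ((d : ℝ) - s) := by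
    refine Real.rpow_lt_rpow (div_nonneg (by linarith) (by linarith)) ?_ hds
    rw [div_lt_div_iff₀ (by linarith) (by linarith)]
    nlinarith
  have hg1 : ((R₂ - 1) / (R₂ + 1)) ^ ((d : ℝ) - s) ≤ 1 :=
    Real.rpow_le_one (div_nonneg (by linarith) (by linarith))
      ((div_le_one (by linarith)).2 (by linarith)) hds.le
  have hJ := relativePotential_antitone (d := d) hs h₁ h.le
  have hJ1 := one_le_relativePotential (d := d) hs h₂
  refine mul_lt_mul'' ?_ (by linarith) (Real.rpow_nonneg (by linarith) _) (by linarith)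
  exact Real.rpow_lt_rpow_of_neg (by linarith) (by linarith) (by linarith)

theorem continuousOn_criticalFunction (hs : 0 < s) (hsd : s < d) :
    ContinuousOn (criticalFunction d s) (Ici 1) := by
  refine (continuousOn_uniformPotential hs hsd).sub (ContinuousOn.div ?_ (by fun_prop) ?_)
  · exact ContinuousOn.rpow_const (by fun_prop) fun R _ => Or.inr (by linarith)
  · intro R hR
    have : (1 : ℝ) ≤ R := hR
    positivity

theorem criticalFunction_one (hs : 0 < s) (hsd : s < d) :
    criticalFunction d s 1 = sphereEnergy d s := by
  rw [criticalFunction, uniformPotential_one, ← sphereEnergy_eq hs hsd, sub_self,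
    Real.zero_rpow (by linarith), zero_div, sub_zero]

theorem criticalFunction_lt_sphereEnergy (hs : 0 < s) (hsd : s < d) {R : ℝ} (hR : 1 < R) :
    criticalFunction d s R < sphereEnergy d s := by
  have hanti := strictAntiOn_criticalFunction (d := d) hs hsd
  -- The limit at `1` gives only a weak inequality; an intermediate radius makes it strict.
  obtain ⟨R', h1, h2⟩ := exists_between hR
  refine (hanti h1 hR h2).trans_le ?_
  rw [← criticalFunction_one hs hsd]
  have ht := (continuousOn_criticalFunction (d := d) hs hsd 1 self_mem_Ici).mono_left
    (nhdsWithin_mono _ Ioi_subset_Ici_self)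
  refine ge_of_tendsto ht ?_
  filter_upwards [Ioo_mem_nhdsGT h1] with r hr
  exact (hanti hr.1 h1 hr.2).le

theorem exists_criticalFunction_lt (hs : 0 < s) (hsd : s < d) {c : ℝ} (hc : 0 < c) :
    ∃ R, 1 < R ∧ criticalFunction d s R < c := by
  -- The relative potential is decreasing, so for `R ≥ 2` its value at `2` bounds it and the factor
  -- `(R + 1)^(-s)` forces decay.
  have ht : Filter.Tendsto (fun R : ℝ => (R + 1) ^ (-s) * relativePotential d s 2) Filter.atTop
      (nhds (0 * relativePotential d s 2)) :=
    ((tendsto_rpow_neg_atTop hs).comp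
      (Filter.tendsto_atTop_add_const_right _ 1 Filter.tendsto_id)).mul_const _
  rw [zero_mul] at ht
  obtain ⟨R, h1, h2⟩ := ((ht.eventually_lt_const hc).and (Filter.eventually_ge_atTop 2)).exists
  have hR : 1 < R := by linarith
  refine ⟨R, hR, lt_of_le_of_lt ?_ h1⟩
  rw [criticalFunction_eq hs hsd hR]
  refine mul_le_mul_of_nonneg_left ?_ (Real.rpow_nonneg (by linarith) _)
  have := relativePotential_antitone (d := d) hs one_lt_two h2
  have h3 : 0 ≤ ((R - 1) / (R + 1)) ^ ((d : ℝ) - s) :=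
    Real.rpow_nonneg (div_nonneg (by linarith) (by linarith)) _
  linarith

theorem exists_criticalFunction_eq (hs : 0 < s) (hsd : s < d) {c : ℝ} (hc : 0 < c)
    (hcW : c < sphereEnergy d s) : ∃ R, 1 < R ∧ criticalFunction d s R = c := by
  obtain ⟨R₀, h1, h2⟩ := exists_criticalFunction_lt hs hsd hc
  have hcont := (continuousOn_criticalFunction (d := d) hs hsd).mono
    (Icc_subset_Ici_self : Icc 1 R₀ ⊆ Ici 1)
  obtain ⟨R, hR, hRc⟩ := intermediate_value_Icc' h1.le hcont
    ⟨h2.le, by rw [criticalFunction_one hs hsd]; exact hcW.le⟩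
  refine ⟨R, lt_of_le_of_ne hR.1 ?_, hRc⟩
  rintro rfl
  rw [criticalFunction_one hs hsd] at hRc
  exact hcW.ne' hRc

end Monotonicity

/-! ### Critical distances, zeros of the Gonchar function and Gonchar's problem -/

section Gonchar

variable {s q R : ℝ}

theorem isCriticalDistance_iff (hR : 1 < R) :
    IsCriticalDistance d s q R ↔ criticalFunction d s R = -(sphereEnergy d s / q) := by
  rw [IsCriticalDistance, criticalFunction, abs_of_pos (by linarith)]
  constructor <;> intro h <;> linarith

theorem goncharC_eq_zero_iff (hR : 1 < R) :
    goncharC d s q R = 0 ↔ criticalFunction d s R = -(sphereEnergy d s / q) := by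
  have h : goncharC d s q R =
      (R ^ (d - 1) * (R + 1) ^ d) * (criticalFunction d s R + sphereEnergy d s / q) := by
    have : (R + 1) ^ d ≠ 0 := by positivity
    rw [goncharC, criticalFunction]
    field_simp
    ring
  have h0 : R ^ (d - 1) * (R + 1) ^ d ≠ 0 := by positivity
  rw [h, mul_eq_zero, or_iff_right h0, add_eq_zero_iff_eq_neg]

theorem infDist_source (hR : 1 < R) : infDist (source d R) (sphere (0 : Space d) 1) = R - 1 := by
  have hmem : source d 1 ∈ sphere (0 : Space d) 1 := by simp [norm_source]
  refine le_antisymm ?_ ((le_infDist ⟨_, hmem⟩).2 fun y hy => ?_)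
  · refine (infDist_le_dist_of_mem hmem).trans_eq ?_
    rw [source_eq_smul R, dist_eq_norm,
      show R • source d 1 - source d 1 = (R - 1) • source d 1 by module, norm_smul,
      norm_source_one, mul_one, Real.norm_eq_abs, abs_of_pos (by linarith)]
  · have h := norm_sub_norm_le (source d R) y
    rw [norm_source, abs_of_pos (by linarith), mem_sphere_zero_iff_norm.1 hy] at h
    rwa [dist_eq_norm]

theorem mem_positivityDistances_iff (hs : 0 < s) (hsd : s < d) (hq : q < 0) {r : ℝ} :
    r ∈ positivityDistances d s q ↔
      0 < r ∧ criticalFunction d s (r + 1) ≤ -(sphereEnergy d s / q) := by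
  constructor
  · rintro ⟨R, hR, rfl, η, hη, hpos⟩
    rw [infDist_source hR, sub_add_cancel]
    exact ⟨by linarith, (hη.isPositiveOnSphere_iff hs hsd hq hR).1 hpos⟩
  · rintro ⟨hr, h⟩
    have hR : 1 < r + 1 := by linarith
    have hη := isSignedEquilibrium_equilibrium q hs hsd hR
    exact ⟨r + 1, hR, by rw [infDist_source hR, add_sub_cancel_right], _, hη,
      (hη.isPositiveOnSphere_iff hs hsd hq hR).2 h⟩

end Gonchar

/-! ### The polynomial case: a recursion in the power and conformal duality -/

section Polynomial

variable {s R : ℝ}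

/-- The mean over the sphere of the power `-s` of the distance to the source. -/
noncomputable def meanPower (d : ℕ) (s R : ℝ) : ℝ :=
  ∫ θ : Sph d, dist (source d R) (θ : Space d) ^ (-s) ∂(sigma d)

theorem dist_source_sq (R : ℝ) (θ : Sph d) : dist (source d R) (θ : Space d) ^ 2 =
    1 + R ^ 2 - 2 * R * ⟪(θ : Space d), source d 1⟫ := by
  rw [source_eq_smul, dist_comm, dist_smul_sq R (norm_coe_sph θ) norm_source_one]

theorem hasDerivAt_dist_rpow (s : ℝ) (hR : 1 < R) (θ : Sph d) :
    HasDerivAt (fun R => dist (source d R) (θ : Space d) ^ (-s))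
      (-s * (R - ⟪(θ : Space d), source d 1⟫) * dist (source d R) (θ : Space d) ^ (-s - 2)) R := by
  have hpos := dist_source_pos hR θ
  have h1 : HasDerivAt (fun R : ℝ => 1 + R ^ 2 - 2 * R * ⟪(θ : Space d), source d 1⟫)
      (2 * (R - ⟪(θ : Space d), source d 1⟫)) R := by
    have := (((hasDerivAt_id R).pow 2).const_add 1).sub
      (((hasDerivAt_id R).const_mul 2).mul_const ⟪(θ : Space d), source d 1⟫)
    refine (this.congr_deriv ?_).congr_of_eventuallyEq (Filter.Eventually.of_forall fun x => ?_)
    · simp; ring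
    · simp
  have hfun : (fun R => dist (source d R) (θ : Space d) ^ (-s)) =
      fun R : ℝ => (1 + R ^ 2 - 2 * R * ⟪(θ : Space d), source d 1⟫) ^ (-s / 2) := by
    funext R
    rw [← dist_source_sq, ← Real.rpow_natCast, ← Real.rpow_mul dist_nonneg]
    congr 1
    push_cast
    ring
  rw [hfun]
  have h2 := h1.rpow_const (p := -s / 2) (Or.inl (by rw [← dist_source_sq]; positivity))
  refine h2.congr_deriv ?_
  rw [← dist_source_sq, ← Real.rpow_natCast, ← Real.rpow_mul dist_nonneg]
  have : ((2 : ℕ) : ℝ) * (-s / 2 - 1) = -s - 2 := by push_cast; ring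
  rw [this]
  ring

theorem continuous_dist_source_rpow (s : ℝ) (hR : 1 < R) :
    Continuous fun θ : Sph d => dist (source d R) (θ : Space d) ^ (-s) :=
  Continuous.rpow_const (by fun_prop) fun θ => Or.inl (dist_source_pos hR θ).ne'

/-- Differentiate under the integral and use `2R (R - v) = |a - θ|² + (R² - 1)`, where `v` is the
inner product of `θ` with the axis; this expresses the derivative through the powers `s` and `s +
2`. -/
theorem hasDerivAt_meanPower (s : ℝ) (hR : 1 < R) :
    HasDerivAt (meanPower d s)
      (-s / (2 * R) * (meanPower d s R + (R ^ 2 - 1) * meanPower d (s + 2) R)) R := by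
  set F' : ℝ → Sph d → ℝ := fun R θ =>
    -s * (R - ⟪(θ : Space d), source d 1⟫) * dist (source d R) (θ : Space d) ^ (-s - 2) with hF'
  obtain ⟨r, hr1, hrR⟩ := exists_between hR
  have hcont : ContinuousOn (fun p : ℝ × Sph d => F' p.1 p.2) (Icc r (R + 1) ×ˢ univ) := by
    refine ContinuousOn.mul (by fun_prop) (ContinuousOn.rpow_const ?_ fun p hp => Or.inl ?_)
    · exact ((continuous_source.comp continuous_fst).dist
        (continuous_subtype_val.comp continuous_snd)).continuousOn
    · exact (dist_source_pos (hr1.trans_le hp.1.1) p.2).ne'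
  obtain ⟨C, hC⟩ := (isCompact_Icc.prod isCompact_univ).exists_bound_of_continuousOn hcont
  have hF'c : Continuous (F' R) :=
    Continuous.mul (by fun_prop)
      (Continuous.rpow_const (by fun_prop) fun θ => Or.inl (dist_source_pos hR θ).ne')
  have h := hasDerivAt_integral_of_dominated_loc_of_deriv_le (μ := sigma d) (x₀ := R)
    (F := fun R (θ : Sph d) => dist (source d R) (θ : Space d) ^ (-s)) (F' := F')
    (s := Ioo r (R + 1)) (bound := fun _ => C) (Ioo_mem_nhds hrR (by linarith))
    (Filter.eventually_of_mem (Ioi_mem_nhds hR) fun R' hR' =>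
      (continuous_dist_source_rpow s hR').aestronglyMeasurable)
    (integrable_of_continuous (continuous_dist_source_rpow s hR))
    hF'c.aestronglyMeasurable
    (ae_of_all _ fun θ R' hR' => hC (R', θ) ⟨Ioo_subset_Icc_self hR', mem_univ _⟩)
    (integrable_const _)
    (ae_of_all _ fun θ R' hR' => hasDerivAt_dist_rpow s (hr1.trans hR'.1) θ)
  refine h.2.congr_deriv ?_
  have hi1 : Integrable (fun θ : Sph d => dist (source d R) (θ : Space d) ^ (-s)) (sigma d) :=
    integrable_of_continuous (continuous_dist_source_rpow s hR)
  have hi2 : Integrable (fun θ : Sph d => dist (source d R) (θ : Space d) ^ (-(s + 2))) (sigma d) :=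
    integrable_of_continuous (continuous_dist_source_rpow (s + 2) hR)
  rw [meanPower, meanPower, ← integral_const_mul, ← integral_add hi1 (hi2.const_mul _),
    ← integral_const_mul]
  refine integral_congr_ae (ae_of_all _ fun θ => ?_)
  have hpos := dist_source_pos hR θ
  have hsq := dist_source_sq R θ
  have e1 : dist (source d R) (θ : Space d) ^ (-s) =
      dist (source d R) (θ : Space d) ^ 2 * dist (source d R) (θ : Space d) ^ (-s - 2) := by
    rw [← Real.rpow_natCast, ← Real.rpow_add hpos]
    congr 1
    push_cast
    ring
  have e2 : -(s + 2) = -s - 2 := by ring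
  have hR0 : R ≠ 0 := by linarith
  simp only [hF', e1, e2, hsq]
  field_simp
  ring

theorem meanPower_eq_uniformPotential (hs : 0 < s) (hsd : s < d) (hR : 1 < R) :
    meanPower d s R = uniformPotential d s R :=
  (uniformPotential_eq_integral hs hsd hR.le).symm

/-- The conformal duality between the powers `s` and `2 * d - s`. -/
theorem meanPower_dual (hs : 0 < s) (hsd : s < d) (hR : 1 < R) :
    meanPower d (2 * d - s) R = (R ^ 2 - 1) ^ (s - d) * meanPower d s R := by
  have hw : 0 < R ^ 2 - 1 := by nlinarith
  rw [meanPower_eq_uniformPotential hs hsd hR,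
    ← integral_balayageDensity hs hsd hR (norm_source_one (d := d)), meanPower,
    ← integral_const_mul]
  refine integral_congr_ae (ae_of_all _ fun θ => ?_)
  simp only [balayageDensity]
  rw [← mul_assoc, ← Real.rpow_add hw, ← source_eq_smul, dist_comm, neg_sub]
  simp

/-- Apply the derivative formula at the dual power `2d - (s + 2)`, whose successor `2d - s` is dual
to `s`. Duality turns every term into the powers `s` and `s + 2`, and the equation is solved for the
power `s`. -/
theorem meanPower_eq_of_dual (hs : 0 < s) (hsd : s + 2 < d) (hR : 1 < R) {V' : ℝ}
    (hV' : HasDerivAt (meanPower d (s + 2)) V' R) :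
    meanPower d s R = -(R ^ 2 - 1) * meanPower d (s + 2) R - 2 * R / (2 * d - (s + 2)) *
      ((s + 2 - d) * (2 * R) * meanPower d (s + 2) R + (R ^ 2 - 1) * V') := by
  have hw : 0 < R ^ 2 - 1 := by nlinarith
  have hc : 0 < 2 * (d : ℝ) - (s + 2) := by linarith
  have h1 := hasDerivAt_meanPower (d := d) (2 * d - (s + 2)) hR
  have hsq : HasDerivAt (fun R : ℝ => R ^ 2 - 1) (2 * R) R := by
    simpa using (hasDerivAt_pow 2 R).sub_const 1
  have h2 := ((hsq.rpow_const (p := s + 2 - d) (Or.inl hw.ne')).mul hV').congr_of_eventuallyEq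
    (f₁ := meanPower d (2 * d - (s + 2)))
    (Filter.eventually_of_mem (Ioi_mem_nhds hR) fun R' hR' => meanPower_dual (by linarith) hsd hR')
  have h3 := h1.unique h2
  rw [meanPower_dual (by linarith) hsd hR, show 2 * (d : ℝ) - (s + 2) + 2 = 2 * d - s by ring,
    meanPower_dual hs (by linarith) hR, show s + 2 - d - 1 = s - d + 1 by ring,
    show s + 2 - d = s - d + 1 + 1 by ring, Real.rpow_add_one hw.ne', Real.rpow_add_one hw.ne'] at h3
  have hp := Real.rpow_pos_of_pos hw (s - d)
  have hR0 : R ≠ 0 := by linarith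
  set P := (R ^ 2 - 1) ^ (s - d)
  set w := R ^ 2 - 1
  set c := 2 * (d : ℝ) - (s + 2)
  have hne : P * w * (c / (2 * R)) ≠ 0 := by positivity
  refine mul_left_cancel₀ hne ?_
  have hcR : c / (2 * R) * (2 * R / c) = 1 := by field_simp
  linear_combination -h3 + (P * w) * ((s + 2 - d) * (2 * R) * meanPower d (s + 2) R + w * V') * hcR

/-- The potential of the uniform measure is elementary when `d - 1 - s` is an even integer. -/
theorem exists_polynomial_meanPower (d m : ℕ) : ∀ s : ℝ, 0 < s → s = (d : ℝ) - 1 - 2 * m →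
    ∃ P : Polynomial ℝ, ∀ R : ℝ, 1 < R → R ^ (d - 1) * meanPower d s R = P.eval R := by
  induction m with
  | zero =>
    intro s hs hsm
    have hsd : s < d := by rw [hsm]; simp
    have hd1 : ((d - 1 : ℕ) : ℝ) = s := by
      have : 1 ≤ d := by
        by_contra! h
        have : d = 0 := by omega
        subst this; simp at hsm; linarith
      rw [hsm]; push_cast [this]; ring
    have hderiv : ∀ R ∈ Ioi (1 : ℝ), HasDerivAt (fun R => R ^ (d - 1) * meanPower d s R) 0 R := by
      intro R hR
      have hR : 1 < R := hR
      have hw : R ^ 2 - 1 ≠ 0 := by nlinarith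
      -- For `s = d - 1` the dual power is `s + 2`, so the derivative formula closes to `M' = -(s/R)
      -- M` for `M = meanPower d s`, and `R^(d-1) M` is constant.
      refine ((hasDerivAt_pow (d - 1) R).mul (hasDerivAt_meanPower s hR)).congr_deriv ?_
      have hdual := meanPower_dual (d := d) hs hsd hR
      rw [show 2 * (d : ℝ) - s = s + 2 by rw [hsm]; push_cast; ring,
        show s - d = -1 by rw [hsm]; push_cast; ring, Real.rpow_neg_one] at hdual
      rw [hdual, hd1]
      have hR0 : R ≠ 0 := by linarith
      have hpow : s * R ^ (d - 1 - 1) * R = s * R ^ (d - 1) := by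
        have : d - 1 ≠ 0 := fun h => by rw [h] at hd1; simp at hd1; linarith
        rw [mul_assoc, pow_sub_one_mul this]
      rw [mul_inv_cancel_left₀ hw]
      field_simp
      linear_combination (2 * meanPower d s R) * hpow
    refine ⟨Polynomial.C (2 ^ (d - 1) * meanPower d s 2), fun R hR => ?_⟩
    rw [Polynomial.eval_C]
    exact isOpen_Ioi.is_const_of_deriv_eq_zero isPreconnected_Ioi
      (fun R hR => (hderiv R hR).differentiableAt.differentiableWithinAt)
      (fun R hR => (hderiv R hR).deriv) hR (mem_Ioi.2 one_lt_two)
  | succ m ih =>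
    intro s hs hsm
    have hsd : s + 2 < d := by rw [hsm]; push_cast; linarith [(Nat.cast_nonneg m : (0 : ℝ) ≤ m)]
    have hd1 : d - 1 ≠ 0 := by
      intro h
      have : (d : ℝ) ≤ 1 := by exact_mod_cast (by omega : d ≤ 1)
      linarith
    obtain ⟨p, hp⟩ := ih (s + 2) (by linarith) (by rw [hsm]; push_cast; ring)
    -- This is the recursion multiplied by `R^(d-1)`. Its factor `2R` absorbs the power lost in
    -- differentiating `R^(d-1)`, since `R * R^(d-1) * V' = R * p' - (d - 1) * p`.
    refine ⟨-(Polynomial.X ^ 2 - 1) * p - Polynomial.C (2 / (2 * d - (s + 2))) *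
      (Polynomial.C (2 * (s + 2 - d)) * Polynomial.X ^ 2 * p + (Polynomial.X ^ 2 - 1) *
        (Polynomial.X * p.derivative - Polynomial.C ((d - 1 : ℕ) : ℝ) * p)), fun R hR => ?_⟩
    have hV := hasDerivAt_meanPower (d := d) (s + 2) hR
    set V' := -(s + 2) / (2 * R) *
      (meanPower d (s + 2) R + (R ^ 2 - 1) * meanPower d (s + 2 + 2) R)
    have h1 := ((hasDerivAt_pow (d - 1) R).mul hV).unique ((p.hasDerivAt R).congr_of_eventuallyEq
      (Filter.eventually_of_mem (Ioi_mem_nhds hR) fun R' hR' => hp R' hR'))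
    have hpow : R ^ (d - 1 - 1) * R = R ^ (d - 1) := pow_sub_one_mul hd1 R
    simp only [Polynomial.eval_sub, Polynomial.eval_mul, Polynomial.eval_neg, Polynomial.eval_pow,
      Polynomial.eval_X, Polynomial.eval_one, Polynomial.eval_C, Polynomial.eval_add, ← h1, ← hp R hR]
    rw [meanPower_eq_of_dual hs hsd hR hV, ← hpow]
    ring

theorem goncharC_eq_polynomial {q : ℝ} (m : ℕ) (hs : 0 < s) (hsm : s = (d : ℝ) - 1 - 2 * m) :
    ∃ P : Polynomial ℝ, ∀ R : ℝ, 1 < R → goncharC d s q R = P.eval R := by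
  have hsd : s < d := by rw [hsm]; linarith [(Nat.cast_nonneg m : (0 : ℝ) ≤ m)]
  obtain ⟨p, hp⟩ := exists_polynomial_meanPower d m s hs hsm
  refine ⟨(Polynomial.C (sphereEnergy d s / q) * (Polynomial.X + 1) ^ d -
    (Polynomial.X - 1) ^ (1 + 2 * m)) * Polynomial.X ^ (d - 1) + (Polynomial.X + 1) ^ d * p,
    fun R hR => ?_⟩
  have hexp : (R - 1) ^ ((d : ℝ) - s) = (R - 1) ^ (1 + 2 * m) := by
    rw [← Real.rpow_natCast]
    congr 1
    rw [hsm]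
    push_cast
    ring
  simp only [Polynomial.eval_sub, Polynomial.eval_mul, Polynomial.eval_pow, Polynomial.eval_X,
    Polynomial.eval_one, Polynomial.eval_C, Polynomial.eval_add, ← hp R hR]
  rw [goncharC, hexp, meanPower_eq_uniformPotential hs hsd hR]
  ring

end Polynomial

end RieszSphere

/-! ### Assembly of the weak, strong and polynomial cases -/

theorem mainTheorem5 (d : ℕ) (s q : ℝ) (hs : 0 < s) (hsd : s < d) (hq : q < 0) :
    -- for every exterior source the signed equilibrium exists and is unique
    (∀ R : ℝ, 1 < R →
      ∃! η : MeasureTheory.SignedMeasure (RieszSphere.Sph d),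
        RieszSphere.IsSignedEquilibrium d s q R η) ∧
    -- weak charges
    (-1 ≤ q →
      (∀ R : ℝ, 1 < R → ∀ η : MeasureTheory.SignedMeasure (RieszSphere.Sph d),
        RieszSphere.IsSignedEquilibrium d s q R η → RieszSphere.IsPositiveOnSphere η) ∧
      (¬ ∃ R : ℝ, 1 < R ∧ RieszSphere.IsCriticalDistance d s q R) ∧
      (¬ ∃ r : ℝ, RieszSphere.IsGoncharSolution d s q r)) ∧
    -- strong charges
    (q < -1 →
      ∃ Rq : ℝ,
        (1 < Rq ∧ RieszSphere.goncharC d s q Rq = 0 ∧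
          ∀ R : ℝ, 1 < R → RieszSphere.goncharC d s q R = 0 → R = Rq) ∧
        (∀ R : ℝ, 1 < R → ∀ η : MeasureTheory.SignedMeasure (RieszSphere.Sph d),
          RieszSphere.IsSignedEquilibrium d s q R η →
            ((RieszSphere.IsPositiveOnSphere η ↔ Rq ≤ R) ∧ (0 ≤ η ↔ Rq ≤ R))) ∧
        (∀ R : ℝ, 1 < R → (RieszSphere.IsCriticalDistance d s q R ↔ R = Rq)) ∧
        RieszSphere.IsGoncharSolution d s q (Rq - 1)) ∧
    -- the polynomial case
    (∀ m : ℕ, s = (d : ℝ) - 1 - 2 * m →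
      ∃ P : Polynomial ℝ, ∀ R : ℝ, 1 < R → RieszSphere.goncharC d s q R = P.eval R) := by
  have hW := RieszSphere.sphereEnergy_pos hs hsd
  have hanti := RieszSphere.strictAntiOn_criticalFunction (d := d) hs hsd
  refine ⟨fun R hR => ⟨_, RieszSphere.isSignedEquilibrium_equilibrium q hs hsd hR,
    fun η hη => hη.unique hs hsd (RieszSphere.isSignedEquilibrium_equilibrium q hs hsd hR)⟩,
    fun hq1 => ?_, fun hq1 => ?_, fun m hm => RieszSphere.goncharC_eq_polynomial m hs hm⟩
  · have hWq : RieszSphere.sphereEnergy d s ≤ -(RieszSphere.sphereEnergy d s / q) := by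
      rw [← div_neg, le_div_iff₀ (neg_pos.2 hq)]
      nlinarith
    have hlt : ∀ R : ℝ, 1 < R →
        RieszSphere.criticalFunction d s R < -(RieszSphere.sphereEnergy d s / q) := fun R hR =>
      (RieszSphere.criticalFunction_lt_sphereEnergy hs hsd hR).trans_le hWq
    refine ⟨fun R hR η hη => (hη.isPositiveOnSphere_iff hs hsd hq hR).2 (hlt R hR).le, ?_, ?_⟩
    · rintro ⟨R, hR, hcrit⟩
      exact (hlt R hR).ne ((RieszSphere.isCriticalDistance_iff hR).1 hcrit)
    · rintro ⟨r, hr, hmin⟩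
      rw [RieszSphere.mem_positivityDistances_iff hs hsd hq] at hr
      -- Every positive distance is admissible, so half of a supposed minimum is a smaller one.
      have h2 := hmin ((RieszSphere.mem_positivityDistances_iff hs hsd hq).2
        ⟨half_pos hr.1, (hlt _ (by linarith [hr.1])).le⟩)
      linarith [hr.1]
  · obtain ⟨Rq, hRq, hcrit⟩ := RieszSphere.exists_criticalFunction_eq hs hsd
      (c := -(RieszSphere.sphereEnergy d s / q))
      (neg_pos.2 (div_neg_of_pos_of_neg hW hq)) (by
        rw [← div_neg, div_lt_iff₀ (neg_pos.2 hq)]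
        nlinarith)
    have heq : ∀ R : ℝ, 1 < R → (RieszSphere.criticalFunction d s R =
        -(RieszSphere.sphereEnergy d s / q) ↔ R = Rq) := fun R hR => by
      rw [← hcrit]
      exact hanti.injOn.eq_iff hR hRq
    have hle : ∀ R : ℝ, 1 < R → (RieszSphere.criticalFunction d s R ≤
        -(RieszSphere.sphereEnergy d s / q) ↔ Rq ≤ R) := fun R hR => by
      rw [← hcrit]
      exact hanti.le_iff_ge hR hRq
    refine ⟨Rq, ⟨hRq, (RieszSphere.goncharC_eq_zero_iff hRq).2 hcrit, fun R hR h =>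
      (heq R hR).1 ((RieszSphere.goncharC_eq_zero_iff hR).1 h)⟩, fun R hR η hη =>
      ⟨(hη.isPositiveOnSphere_iff hs hsd hq hR).trans (hle R hR),
        (hη.nonneg_iff hs hsd hq hR).trans (hle R hR)⟩, fun R hR =>
      (RieszSphere.isCriticalDistance_iff hR).trans (heq R hR), ?_, fun r hr => ?_⟩
    · rw [RieszSphere.mem_positivityDistances_iff hs hsd hq, sub_add_cancel]
      exact ⟨by linarith, hcrit.le⟩
    · rw [RieszSphere.mem_positivityDistances_iff hs hsd hq] at hr
      linarith [(hle (r + 1) (by linarith [hr.1])).1 hr.2]
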